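/- For a profinite group $H$ let $\mathrm{d}(H) \in \mathbb{N}_0 \cup \{\infty\}$ denote the minimal cardinality of a topological generating set of $H$ ($\infty$ if there is no finite one). The lower rank of a profinite group $G$ is $\mathrm{lr}(G) = \liminf \{\mathrm{d}(H) \mid H \le_{\mathrm{o}} G\} \in \mathbb{N}_0 \cup \{\infty\}$, the limit inferior being taken over the net of all open subgroups $H$ of $G$, ordered by reverse inclusion. A profinite group is just infinite if it is infinite and each of its non-trivial closed normal subgroups is open; it is hereditarily just infinite if all of its open subgroups are just infinite. For a prime $p$, a profinite group is virtually-$\mathbb{Z}_p$ if it has an open subgroup that is an infinite procyclic pro-$p$ group (equivalently, an open subgroup isomorphic to $\mathbb{Z}_p$). Let $G = \prod_{i=1}^n G_i$ be a non-trivial direct product of finitely many hereditarily just infinite profinite groups, each of finite lower rank. Set \[ d = \max \{\mathrm{lr}(G_i) \mid 1 \le i \le n\} \quad \text{and} \quad r = \max \{ r_p \mid p \text{ prime} \}, \] where $r_p$ denotes the number of indices $i \in \{1, \ldots, n\}$ such that $G_i$ is virtually-$\mathbb{Z}_p$. Then $\mathrm{lr}(G) = \max\{d, r\}$. -/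

import Mathlib

open Filter

noncomputable section

/-- The minimal cardinality of a topological generating set of `G`,
equal to `⊤` if `G` is not topologically finitely generated. -/
def topRank (G : Type*) [Group G] [TopologicalSpace G] [IsTopologicalGroup G] : ℕ∞ :=
  ⨅ (S : Finset G) (_ : (Subgroup.closure (S : Set G)).topologicalClosure = ⊤), (S.card : ℕ∞)

/-- The lower rank of `G`: the limit inferior of `topRank H`, taken over the net of all open
subgroups `H` of `G`, ordered by reverse inclusion. -/
def lowerRank (G : Type*) [Group G] [TopologicalSpace G] [IsTopologicalGroup G] : ℕ∞ :=
  liminf (fun H : OpenSubgroup G => topRank H.toSubgroup) atBot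

/-- `G` is infinite and every non-trivial closed normal subgroup of `G` is open. -/
structure IsJustInfinite (G : Type*) [Group G] [TopologicalSpace G] : Prop where
  infinite : Infinite G
  isOpen_of_isClosed (N : Subgroup G) (hN : N.Normal) (hc : IsClosed (N : Set G))
    (hne : N ≠ ⊥) : IsOpen (N : Set G)

/-- Every open subgroup of `G` (in particular `G` itself) is just infinite. -/
def IsHereditarilyJustInfinite (G : Type*) [Group G] [TopologicalSpace G] : Prop :=
  ∀ H : OpenSubgroup G, IsJustInfinite H.toSubgroup

/-- `G` has a dense cyclic subgroup. -/
def IsProcyclic (G : Type*) [Group G] [TopologicalSpace G] [IsTopologicalGroup G] : Prop :=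
  ∃ g : G, (Subgroup.zpowers g).topologicalClosure = ⊤

/-- Every open normal subgroup of `G` has index a power of `p`. -/
def IsProP (p : ℕ) (G : Type*) [Group G] [TopologicalSpace G] : Prop :=
  ∀ N : OpenNormalSubgroup G, ∃ k : ℕ, N.toSubgroup.index = p ^ k

/-- `G` is virtually-`ℤ_p`: some open subgroup of `G` is an infinite procyclic pro-`p` group. -/
def IsVirtuallyZp (p : ℕ) (G : Type*) [Group G] [TopologicalSpace G] [IsTopologicalGroup G] :
    Prop :=
  ∃ H : OpenSubgroup G, Infinite H.toSubgroup ∧ IsProcyclic H.toSubgroup ∧ IsProP p H.toSubgroup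

end

open scoped commutatorElement

/-! ### Topological generation and lower rank -/

section Rank

variable {G : Type*} [Group G] [TopologicalSpace G] [IsTopologicalGroup G]

/-! Lower bound. Projection onto a factor sends open subgroups to open subgroups and cannot increase
the number of generators, so each `lowerRank (G i)` is a lower bound. For a prime `p`, a small open
subgroup of the product maps onto a finite-index subgroup of a product of `r_p` infinite procyclic
pro-`p` groups. These are torsion-free, so passing to finite index preserves the index of the
subgroup of `p`-th powers. That index is at least `p ^ r_p`, which forces `r_p` generators
(`le_topRank_of_pow_le_index`).

Upper bound. Let `m` be the claimed value. Inside a given open subgroup, choose small open `H i ≤ G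
i` with at most `m` generators and combine these coordinatewise into `m` elements of the product.
They generate topologically a closed subgroup `K` projecting onto every `H i`. The point is to make
`K` open, for which it suffices that `K` meets every factor nontrivially: the intersection is
normalized by `H i`, hence open by just infiniteness (`isOpen_of_subdirect`).

A factor that is not virtually abelian causes no obstruction if its `H i` is isomorphic to no other
`H l`: a Goursat argument treats two coordinates, and commutators combine the coordinates. Such
choices exist because an isomorphism between two terms of a strictly descending chain of open
subgroups is a proper open self-embedding, which a finitely generated just infinite group admits
only if it is virtually abelian (`isVirtuallyAbelian_of_self_embedding`).

A virtually abelian factor is virtually `ℤ_p` for some prime `p`. Its `H i` is procyclic and its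
generator is put into one of the `m` slots. Since `r_p ≤ m`, factors with the same prime can get
different slots, and components sharing a slot are then separated by coprimality
(`mulSingle_mem_of_coprime`). -/

theorem topRank_le_of_range {m : ℕ} (g : Fin m → G)
    (hg : (Subgroup.closure (Set.range g)).topologicalClosure = ⊤) : topRank G ≤ m := by
  classical
  refine (iInf₂_le (Finset.univ.image g) (by simpa using hg)).trans ?_
  exact_mod_cast Finset.card_image_le.trans (by simp)

theorem exists_finset_of_topRank_le {m : ℕ} (h : topRank G ≤ m) :
    ∃ S : Finset G, (Subgroup.closure (S : Set G)).topologicalClosure = ⊤ ∧ S.card ≤ m := by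
  have h' : topRank G < (m + 1 : ℕ) := h.trans_lt (by exact_mod_cast m.lt_succ_self)
  unfold topRank at h'
  simp only [iInf_lt_iff] at h'
  obtain ⟨S, hS, hc⟩ := h'
  exact ⟨S, hS, by exact_mod_cast Nat.lt_succ_iff.mp (by exact_mod_cast hc)⟩

theorem exists_range_of_topRank_le {m : ℕ} (h : topRank G ≤ m) :
    ∃ g : Fin m → G, (Subgroup.closure (Set.range g)).topologicalClosure = ⊤ := by
  obtain ⟨S, hS, hc⟩ := exists_finset_of_topRank_le h
  let e := S.equivFin.symm
  -- Pad with `1` to obtain exactly `m` generators.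
  refine ⟨fun j => if hj : (j : ℕ) < S.card then e ⟨j, hj⟩ else 1, ?_⟩
  refine top_le_iff.mp (hS ▸ Subgroup.topologicalClosure_mono ((Subgroup.closure_le _).2 ?_))
  intro s hs
  refine Subgroup.subset_closure ⟨⟨S.equivFin ⟨s, hs⟩, by omega⟩, ?_⟩
  simp [e]

theorem exists_finset_of_topRank_lt_top (h : topRank G < ⊤) :
    ∃ S : Finset G, (Subgroup.closure (S : Set G)).topologicalClosure = ⊤ := by
  lift topRank G to ℕ using h.ne with m hm
  obtain ⟨S, hS, -⟩ := exists_finset_of_topRank_le hm.symm.le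
  exact ⟨S, hS⟩

theorem topRank_le_of_surjective {H : Type*} [Group H] [TopologicalSpace H] [IsTopologicalGroup H]
    (f : G →* H) (hf : Continuous f) (hs : Function.Surjective f) : topRank H ≤ topRank G := by
  classical
  refine le_iInf₂ fun S hS => ?_
  have hd : ((Subgroup.closure (S : Set G)).map f).topologicalClosure = ⊤ := by
    have h1 : Dense ((Subgroup.closure (S : Set G) : Subgroup G) : Set G) := by
      rw [dense_iff_closure_eq, ← Subgroup.topologicalClosure_coe, hS]; rfl
    have h2 := hs.denseRange.dense_image hf h1
    apply SetLike.coe_injective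
    rw [Subgroup.topologicalClosure_coe, Subgroup.coe_map, h2.closure_eq]; rfl
  rw [MonoidHom.map_closure] at hd
  refine (iInf₂_le (S.image f) (by simpa using hd)).trans ?_
  exact_mod_cast Finset.card_image_le

theorem lowerRank_le {m : ℕ∞}
    (h : ∀ U : OpenSubgroup G, ∃ H ≤ U, topRank H.toSubgroup ≤ m) : lowerRank G ≤ m :=
  liminf_le_of_frequently_le (frequently_atBot.2 h)

theorem le_lowerRank {m : ℕ∞} (U : OpenSubgroup G)
    (h : ∀ H ≤ U, m ≤ topRank H.toSubgroup) : m ≤ lowerRank G :=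
  le_liminf_of_le (h := eventually_atBot.2 ⟨U, h⟩)

/-- Ranks are discrete, so a finite limit inferior is attained or undercut below every open
subgroup, not merely approached. -/
theorem exists_topRank_le_lowerRank (hG : lowerRank G < ⊤) (U : OpenSubgroup G) :
    ∃ H ≤ U, topRank H.toSubgroup ≤ lowerRank G := by
  have h : ∃ᶠ H : OpenSubgroup G in atBot, topRank H.toSubgroup < lowerRank G + 1 :=
    frequently_lt_of_liminf_lt (h := ENat.lt_add_one_iff hG.ne |>.2 le_rfl)
  obtain ⟨H, hHU, hH⟩ := frequently_atBot.1 h U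
  exact ⟨H, hHU, (ENat.lt_add_one_iff hG.ne).1 hH⟩

theorem exists_le_topRank {m : ℕ} (hm : (m : ℕ∞) ≤ lowerRank G) :
    ∃ U : OpenSubgroup G, ∀ H ≤ U, (m : ℕ∞) ≤ topRank H.toSubgroup := by
  rcases m with _ | m
  · exact ⟨⊤, fun _ _ => by simp⟩
  by_contra! hcon
  have : lowerRank G ≤ m := lowerRank_le fun U => by
    obtain ⟨H, hU, hH⟩ := hcon U
    refine ⟨H, hU, ?_⟩
    push_cast at hH
    exact (ENat.lt_add_one_iff (ENat.natCast_ne_top m)).1 hH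
  exact absurd (hm.trans this) (by exact_mod_cast Nat.not_succ_le_self m)

end Rank

/-! ### Compact groups -/

section Compact

theorem isOpen_of_isClosed_of_index_ne_zero {G : Type*} [Group G] [TopologicalSpace G]
    [IsTopologicalGroup G] {U : Subgroup G} (hc : IsClosed (U : Set G))
    (h : U.index ≠ 0) : IsOpen (U : Set G) := by
  have : U.FiniteIndex := ⟨h⟩
  exact U.isOpen_of_isClosed_of_finiteIndex hc

variable {G : Type*} [Group G] [TopologicalSpace G] [CompactSpace G]

theorem isClosed_map_of_isClosed {H : Type*} [Group H] [TopologicalSpace H] [T2Space H]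
    (f : G →* H) (hf : Continuous f) {K : Subgroup G} (hK : IsClosed (K : Set G)) :
    IsClosed (K.map f : Set H) := by
  rw [Subgroup.coe_map]
  exact (hK.isCompact.image hf).isClosed

/-- Compactness: a directed family of closed subgroups cannot keep meeting the closed complement of
an open set that contains its intersection. -/
theorem exists_le_of_iInf_le [T2Space G] {ι : Type*} [Nonempty ι] {F : ι → Subgroup G}
    (hd : Directed (· ≥ ·) F) (hc : ∀ i, IsClosed (F i : Set G)) {N : Subgroup G}
    (hN : IsOpen (N : Set G)) (h : ⨅ i, F i ≤ N) : ∃ i, F i ≤ N := by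
  refine exists_subset_nhds_of_isCompact (V := fun i => (F i : Set G)) (fun i j => hd i j)
    (fun i => (hc i).isCompact) (U := (N : Set G)) fun x hx => hN.mem_nhds (h ?_)
  simpa [Subgroup.mem_iInf] using hx

variable [IsTopologicalGroup G]

theorem index_ne_zero_of_isOpen {U : Subgroup G} (hU : IsOpen (U : Set G)) : U.index ≠ 0 := by
  have := Subgroup.quotient_finite_of_isOpen U hU
  exact Subgroup.index_ne_zero_of_finite

theorem infinite_of_isOpen [Infinite G] {U : Subgroup G} (hU : IsOpen (U : Set G)) :
    Infinite U := by
  by_contra h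
  rw [not_infinite_iff_finite] at h
  have := Subgroup.quotient_finite_of_isOpen U hU
  have : Finite G := Finite.of_equiv ((G ⧸ U) × U) Subgroup.groupEquivQuotientProdSubgroup.symm
  exact not_finite G

variable [TotallyDisconnectedSpace G]

theorem exists_openNormalSubgroup_notMem {x : G} (hx : x ≠ 1) :
    ∃ V : OpenNormalSubgroup G, x ∉ V := by
  obtain ⟨V, hV⟩ := ProfiniteGrp.exist_openNormalSubgroup_sub_open_nhds_of_one
    (isOpen_compl_singleton (x := x)) (by simpa using hx.symm)
  exact ⟨V, fun h => hV h rfl⟩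

theorem exists_openSubgroup_lt [Infinite G] (U : OpenSubgroup G) : ∃ V : OpenSubgroup G, V < U := by
  have := infinite_of_isOpen U.isOpen
  obtain ⟨⟨x, hxU⟩, hx⟩ := exists_ne (1 : U.toSubgroup)
  obtain ⟨V, hV⟩ := exists_openNormalSubgroup_notMem (x := x) (fun h => hx (Subtype.ext h))
  refine ⟨U ⊓ V.toOpenSubgroup, lt_of_le_of_ne inf_le_left fun h => hV ?_⟩
  rw [← h] at hxU
  exact hxU.2

end Compact

/-! ### Hereditarily just infinite groups -/

section HJI

variable {G : Type*} [Group G] [TopologicalSpace G]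

theorem IsHereditarilyJustInfinite.infinite_openSubgroup (h : IsHereditarilyJustInfinite G)
    (U : OpenSubgroup G) : Infinite U.toSubgroup := (h U).infinite

theorem IsHereditarilyJustInfinite.infinite (h : IsHereditarilyJustInfinite G) : Infinite G :=
  have := h.infinite_openSubgroup ⊤
  Infinite.of_injective _ (Subtype.val_injective (p := (· ∈ (⊤ : OpenSubgroup G).toSubgroup)))

theorem IsHereditarilyJustInfinite.isOpen (h : IsHereditarilyJustInfinite G)
    (U : OpenSubgroup G) {N : Subgroup G} (hNU : N ≤ U.toSubgroup)
    (hconj : ∀ u ∈ U, ∀ n ∈ N, u * n * u⁻¹ ∈ N) (hc : IsClosed (N : Set G)) (hne : N ≠ ⊥) :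
    IsOpen (N : Set G) := by
  have h1 : IsOpen (N.subgroupOf U.toSubgroup : Set U.toSubgroup) := by
    refine (h U).isOpen_of_isClosed _ ⟨fun n hn u => ?_⟩ (hc.preimage continuous_subtype_val) ?_
    · exact hconj u u.2 n hn
    · rw [Ne, Subgroup.subgroupOf_eq_bot, disjoint_comm, Subgroup.disjoint_def]
      intro hd
      exact hne ((Subgroup.eq_bot_iff_forall _).2 fun x hx => hd (hNU hx) hx)
  have h2 := U.isOpen.isOpenMap_subtype_val _ h1
  convert h2 using 1
  ext x
  simp only [Set.mem_image, SetLike.mem_coe, Subtype.exists]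
  exact ⟨fun hx => ⟨x, hNU hx, hx, rfl⟩, fun ⟨y, _, hy, e⟩ => e ▸ hy⟩

/-- Some open subgroup of `G` is abelian. -/
def IsVirtuallyAbelian (G : Type*) [Group G] [TopologicalSpace G] : Prop :=
  ∃ A : OpenSubgroup G, ∀ a ∈ A, ∀ b ∈ A, a * b = b * a

theorem IsVirtuallyAbelian.of_openSubgroup {U : OpenSubgroup G}
    (h : IsVirtuallyAbelian U.toSubgroup) : IsVirtuallyAbelian G := by
  obtain ⟨A, hA⟩ := h
  refine ⟨⟨A.toSubgroup.map U.toSubgroup.subtype, ?_⟩, ?_⟩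
  · exact U.isOpen.isOpenMap_subtype_val _ A.isOpen
  · rintro _ ⟨a, ha, rfl⟩ _ ⟨b, hb, rfl⟩
    exact congrArg Subtype.val (hA a ha b hb)

end HJI

/-! ### Self-embeddings of just infinite groups -/

section SelfEmbedding

variable {H : Type*} [Group H]

/-- The iterates of an endomorphism, as homomorphisms. -/
def iterHom (φ : H →* H) (k : ℕ) : H →* H where
  toFun := φ^[k]
  map_one' := iterate_map_one φ k
  map_mul' := iterate_map_mul φ k

theorem iterHom_apply (φ : H →* H) (k : ℕ) (x : H) : iterHom φ k x = φ^[k] x := rfl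

theorem iterHom_add (φ : H →* H) (j k : ℕ) (x : H) :
    iterHom φ (j + k) x = iterHom φ j (iterHom φ k x) := by
  simp only [iterHom_apply, Function.iterate_add_apply]

theorem iterHom_one (φ : H →* H) (x : H) : iterHom φ 1 x = φ x := by
  simp [iterHom_apply]

theorem iterHom_zero (φ : H →* H) (x : H) : iterHom φ 0 x = x := by
  simp [iterHom_apply]

theorem iterHom_injective {φ : H →* H} (hφ : Function.Injective φ) (k : ℕ) :
    Function.Injective (iterHom φ k) := by
  intro x y h
  simp only [iterHom_apply] at h
  exact hφ.iterate k h

theorem index_range_iterHom {φ : H →* H} (hφ : Function.Injective φ) (k : ℕ) :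
    (iterHom φ k).range.index = φ.range.index ^ k := by
  induction k with
  | zero =>
    have : (iterHom φ 0).range = ⊤ := MonoidHom.range_eq_top.2 fun x => ⟨x, iterHom_zero φ x⟩
    simp [this]
  | succ k ih =>
    have : (iterHom φ (k + 1)).range = φ.range.map (iterHom φ k) := by
      ext x
      simp [iterHom_add, iterHom_one]
    rw [this, Subgroup.index_map_of_injective _ (iterHom_injective hφ k), ih, pow_succ']

theorem range_iterHom_antitone (φ : H →* H) : Antitone fun k => (iterHom φ k).range := by
  refine antitone_nat_of_succ_le fun k => ?_
  rintro _ ⟨x, rfl⟩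
  exact ⟨φ x, by rw [iterHom_add, iterHom_one]⟩

/-- The largest subgroup all of whose images under the iterates of `φ` are contained in the normal
cores of the images of these iterates. -/
def iterCore (φ : H →* H) : Subgroup H :=
  ⨅ k, (iterHom φ k).range.normalCore.comap (iterHom φ k)

theorem iterCore_normal (φ : H →* H) : (iterCore φ).Normal :=
  Subgroup.normal_iInf_normal fun _ => inferInstance

theorem map_iterCore_le (φ : H →* H) : (iterCore φ).map φ ≤ iterCore φ := by
  rintro _ ⟨x, hx, rfl⟩
  simp only [iterCore, SetLike.mem_coe, Subgroup.mem_iInf, Subgroup.mem_comap] at hx ⊢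
  intro k
  have := Subgroup.normalCore_mono (range_iterHom_antitone φ k.le_succ) (hx (k + 1))
  rwa [iterHom_add, iterHom_one] at this

/-- Conjugating `φ^[k+1] x` by `φ g` stays in the image of `φ^[k+1]`; cancelling one `φ` gives the
condition at level `k` for `g`. -/
theorem antitone_comap_normalCore {φ : H →* H} (hφ : Function.Injective φ) :
    Antitone fun k => (iterHom φ k).range.normalCore.comap (iterHom φ k) := by
  refine antitone_nat_of_succ_le fun k x hx => ?_
  intro g
  obtain ⟨y, hy⟩ := hx (φ g)
  refine ⟨y, hφ ?_⟩
  rw [map_mul, map_mul, map_inv, ← iterHom_one φ (iterHom φ k x), ← iterHom_add, add_comm 1 k,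
    ← hy, ← iterHom_one φ (iterHom φ k y), ← iterHom_add, add_comm 1 k]

/-- This is the purpose of `iterCore`: it yields a `φ`-invariant filtration by subgroups normal in
the whole of `H`. -/
theorem map_iterHom_iterCore_normal {φ : H →* H} (hφ : Function.Injective φ) (k : ℕ) :
    ((iterCore φ).map (iterHom φ k)).Normal := by
  refine ⟨?_⟩
  rintro _ ⟨x, hx, rfl⟩ g
  have hx' : ∀ k, iterHom φ k x ∈ (iterHom φ k).range.normalCore := by
    simpa [iterCore, Subgroup.mem_iInf] using hx
  obtain ⟨y, hy⟩ := hx' k g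
  refine ⟨y, ?_, hy⟩
  -- Applying `φ^[j]` to `hy` exhibits `φ^[j+k] y` as a conjugate of `φ^[j+k] x`; antitonicity then
  -- descends from level `j + k` to level `j`.
  have hlarge : ∀ j, iterHom φ (j + k) y ∈ (iterHom φ (j + k)).range.normalCore := by
    intro j
    rw [iterHom_add φ j k y, hy, map_mul, map_mul, map_inv, ← iterHom_add]
    exact (Subgroup.normalCore_normal _).conj_mem _ (hx' (j + k)) _
  simp only [iterCore, SetLike.mem_coe, Subgroup.mem_iInf]
  intro j
  exact antitone_comap_normalCore hφ (Nat.le_add_right j k) (hlarge j)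

variable [TopologicalSpace H]

theorem iterHom_continuous {φ : H →* H} (hc : Continuous φ) (k : ℕ) : Continuous (iterHom φ k) := by
  have : (iterHom φ k : H → H) = φ^[k] := funext (iterHom_apply φ k)
  rw [this]
  exact hc.iterate k

variable [IsTopologicalGroup H]

theorem isClosed_normalCore {N : Subgroup H} (hN : IsClosed (N : Set H)) :
    IsClosed (N.normalCore : Set H) := by
  have : (N.normalCore : Set H) = ⋂ g : H, (fun x => g * x * g⁻¹) ⁻¹' N := by
    ext x
    simp only [Set.mem_iInter]
    rfl
  rw [this]
  exact isClosed_iInter fun g => hN.preimage (by fun_prop)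

variable [CompactSpace H]

/-- Otherwise one more `φ` could be extracted from every element of the core at level `k`, again and
again. A finite-index subgroup would then lie in the images of all iterates, whose indices are
unbounded. -/
theorem not_comap_normalCore_le {φ : H →* H} (hφ : Function.Injective φ)
    (ho : IsOpen (φ.range : Set H)) (hne : φ.range ≠ ⊤) (k : ℕ) :
    ¬ (iterHom φ k).range.normalCore.comap (iterHom φ k) ≤ φ.range := by
  intro hle
  have hstep : ∀ j, k ≤ j →
      (iterHom φ k).range.normalCore ≤ (iterHom φ j).range.normalCore := by
    intro j hj
    induction j, hj using Nat.le_induction with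
    | base => exact le_rfl
    | succ j hj ih =>
      refine ih.trans ?_
      rw [Subgroup.normal_le_normalCore]
      intro x hx
      obtain ⟨y, rfl⟩ := Subgroup.normalCore_le _ hx
      obtain ⟨z, rfl⟩ := hle (antitone_comap_normalCore hφ hj hx)
      exact ⟨z, by rw [iterHom_add, iterHom_one]⟩
  have h0 : φ.range.index ≠ 0 := index_ne_zero_of_isOpen ho
  have h1 : φ.range.index ≠ 1 := fun h => hne (Subgroup.index_eq_one.1 h)
  have hk : (iterHom φ k).range.index ≠ 0 := by
    rw [index_range_iterHom hφ]
    exact pow_ne_zero _ h0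
  have : (iterHom φ k).range.FiniteIndex := ⟨hk⟩
  have hM : (iterHom φ k).range.normalCore.index ≠ 0 := Subgroup.FiniteIndex.index_ne_zero
  set M := (iterHom φ k).range.normalCore
  set j := max k M.index
  have hle' : M ≤ (iterHom φ j).range := (hstep j (le_max_left _ _)).trans (Subgroup.normalCore_le _)
  have hlt := Nat.le_of_dvd (Nat.pos_of_ne_zero hM) (Subgroup.index_dvd_of_le hle')
  rw [index_range_iterHom hφ] at hlt
  have h2 : j < φ.range.index ^ j := Nat.lt_pow_self (by omega)
  have h3 : M.index ≤ j := le_max_right _ _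
  omega

variable [T2Space H]

theorem not_iterCore_le {φ : H →* H} (hφ : Function.Injective φ) (hc : Continuous φ)
    (ho : IsOpen (φ.range : Set H)) (hne : φ.range ≠ ⊤) : ¬ iterCore φ ≤ φ.range := by
  intro h
  obtain ⟨k, hk⟩ := exists_le_of_iInf_le (antitone_comap_normalCore hφ).directed_ge (fun k => by
    refine (isClosed_normalCore ?_).preimage (iterHom_continuous hc k)
    rw [MonoidHom.coe_range]
    exact (isCompact_range (iterHom_continuous hc k)).isClosed) ho h
  exact not_comap_normalCore_le hφ ho hne k hk

theorem isClosed_iterCore {φ : H →* H} (hc : Continuous φ) : IsClosed (iterCore φ : Set H) := by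
  rw [iterCore, Subgroup.coe_iInf]
  refine isClosed_iInter fun k => (isClosed_normalCore ?_).preimage (iterHom_continuous hc k)
  rw [MonoidHom.coe_range]
  exact (isCompact_range (iterHom_continuous hc k)).isClosed

theorem isOpen_iterCore (hH : IsJustInfinite H) {φ : H →* H} (hφ : Function.Injective φ)
    (hc : Continuous φ) (ho : IsOpen (φ.range : Set H)) (hne : φ.range ≠ ⊤) :
    IsOpen (iterCore φ : Set H) :=
  hH.isOpen_of_isClosed _ (iterCore_normal φ) (isClosed_iterCore hc)
    fun h => not_iterCore_le hφ hc ho hne (h ▸ bot_le)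

end SelfEmbedding

/-! ### Actions on finite normal sections -/

section FiniteSections

/-- Such a homomorphism is continuous, hence determined by its values on a finite topological
generating set. -/
theorem finite_setOf_isOpen_ker {H : Type*} [Group H] [TopologicalSpace H] [IsTopologicalGroup H]
    (hH : topRank H < ⊤) (T : Type*) [Group T] [Finite T] :
    {f : H →* T | IsOpen (f.ker : Set H)}.Finite := by
  obtain ⟨S, hS⟩ := exists_finset_of_topRank_lt_top hH
  refine Set.Finite.of_finite_image (f := fun f (s : S) => f s) (Set.toFinite _) ?_
  intro f hf g hg hfg
  have ho : IsOpen (f.eqLocus g : Set H) := by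
    refine Subgroup.isOpen_mono (H₁ := f.ker ⊓ g.ker) ?_ (hf.inter hg)
    rintro x ⟨h1, h2⟩
    exact (MonoidHom.mem_ker.1 h1).trans (MonoidHom.mem_ker.1 h2).symm
  have hle : (Subgroup.closure (S : Set H)).topologicalClosure ≤ f.eqLocus g :=
    Subgroup.topologicalClosure_minimal _
      ((Subgroup.closure_le _).2 fun s hs => congrFun hfg ⟨s, hs⟩)
      (Subgroup.isClosed_of_isOpen _ ho)
  rw [hS] at hle
  ext x
  exact hle (Subgroup.mem_top x)

/-- The map is the conjugation action on `A / B`. Its target depends only on the order of the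
section, so sections of equal order can be treated together. -/
theorem exists_ker_eq_centralizer {H : Type*} [Group H] (A B : Subgroup H) [A.Normal] [B.Normal]
    (hs : B.relIndex A ≠ 0) :
    ∃ f : H →* Equiv.Perm (Fin (B.relIndex A)), ∀ x, x ∈ f.ker ↔ ∀ a ∈ A, ⁅x, a⁆ ∈ B := by
  let Q := A.map (QuotientGroup.mk' B)
  have hQ : Q.Normal := Subgroup.Normal.map inferInstance _ (QuotientGroup.mk'_surjective B)
  have hcard : Nat.card Q = B.relIndex A := by
    rw [← Subgroup.relIndex_ker, QuotientGroup.ker_mk']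
  have : Finite Q := Nat.finite_of_card_ne_zero (hcard ▸ hs)
  let e : Q ≃ Fin (B.relIndex A) := Finite.equivFinOfCardEq hcard
  refine ⟨e.permCongrHom.toMonoidHom.comp ((MulAut.toPerm Q).comp
    ((MulAut.conjNormal (H := Q)).comp (QuotientGroup.mk' B))), fun x => ?_⟩
  have hx : (x ∈ (e.permCongrHom.toMonoidHom.comp ((MulAut.toPerm Q).comp
      ((MulAut.conjNormal (H := Q)).comp (QuotientGroup.mk' B)))).ker) ↔
      ∀ q : Q, (MulAut.conjNormal (QuotientGroup.mk' B x) q : H ⧸ B) = q := by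
    rw [MonoidHom.mem_ker, MonoidHom.comp_apply]
    change e.permCongrHom _ = 1 ↔ _
    rw [map_eq_one_iff _ e.permCongrHom.injective]
    rw [Equiv.ext_iff]
    exact forall_congr' fun q => Subtype.ext_iff
  rw [hx]
  constructor
  · intro h a ha
    have := h ⟨QuotientGroup.mk' B a, Subgroup.mem_map_of_mem _ ha⟩
    rw [MulAut.conjNormal_apply] at this
    rw [← QuotientGroup.ker_mk' B, MonoidHom.mem_ker, map_commutatorElement, commutatorElement_def]
    exact mul_inv_eq_one.2 this
  · rintro h ⟨_, a, ha, rfl⟩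
    have := h a ha
    rw [← QuotientGroup.ker_mk' B, MonoidHom.mem_ker, map_commutatorElement,
      commutatorElement_def] at this
    rw [MulAut.conjNormal_apply]
    exact mul_inv_eq_one.1 this

end FiniteSections

/-! ### Three subgroups lemma and closures -/

section Commutators

theorem commutator_commutator_le_of_rotate {G : Type*} [Group G] {H₁ H₂ H₃ N : Subgroup G}
    [N.Normal] (h1 : ⁅⁅H₂, H₃⁆, H₁⁆ ≤ N) (h2 : ⁅⁅H₃, H₁⁆, H₂⁆ ≤ N) : ⁅⁅H₁, H₂⁆, H₃⁆ ≤ N := by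
  rw [← QuotientGroup.ker_mk' N, ← Subgroup.map_eq_bot_iff] at h1 h2 ⊢
  simp only [Subgroup.map_commutator] at h1 h2 ⊢
  exact Subgroup.commutator_commutator_eq_bot_of_rotate h1 h2

variable {H : Type*} [Group H] [TopologicalSpace H] [IsTopologicalGroup H]

theorem commutator_topologicalClosure_le {A B N : Subgroup H} (hN : IsClosed (N : Set H))
    (h : ⁅A, B⁆ ≤ N) : ⁅A.topologicalClosure, B⁆ ≤ N := by
  rw [Subgroup.commutator_le]
  intro a ha b hb
  have hcl : IsClosed {x : H | ⁅x, b⁆ ∈ N} := by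
    refine hN.preimage ?_
    simp only [commutatorElement_def]
    fun_prop
  exact closure_minimal (fun x hx => Subgroup.commutator_le.1 h x hx b hb) hcl ha

end Commutators

/-! ### Proper open self-embeddings force virtual commutativity -/

section SelfEmbedding

variable {H : Type*} [Group H] [TopologicalSpace H] [IsTopologicalGroup H]
  [CompactSpace H] [T2Space H]

theorem map_iterHom_antitone {H : Type*} [Group H] {φ : H →* H} {P : Subgroup H}
    (hP : P.map φ ≤ P) : Antitone fun k => P.map (iterHom φ k) := by
  refine antitone_nat_of_succ_le fun k => ?_
  rintro _ ⟨x, hx, rfl⟩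
  exact ⟨φ x, hP ⟨x, hx, rfl⟩, by rw [iterHom_add, iterHom_one]⟩

theorem map_iterHom_map_iterHom {H : Type*} [Group H] (φ : H →* H) (P : Subgroup H) (j k : ℕ) :
    (P.map (iterHom φ k)).map (iterHom φ j) = P.map (iterHom φ (j + k)) := by
  rw [Subgroup.map_map]
  congr 1
  ext x
  exact (iterHom_add φ j k x).symm

/-- A topologically finitely generated just infinite group with a proper open self-embedding is
virtually abelian. -/
theorem isVirtuallyAbelian_of_self_embedding (hH : IsJustInfinite H) (hfg : topRank H < ⊤)
    {φ : H →* H} (hφ : Function.Injective φ)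
    (hc : Continuous φ) (ho : IsOpen (φ.range : Set H)) (hne : φ.range ≠ ⊤) :
    IsVirtuallyAbelian H := by
  set P := iterCore φ with hPdef
  have hPo : IsOpen (P : Set H) := isOpen_iterCore hH hφ hc ho hne
  have hPc : IsClosed (P : Set H) := Subgroup.isClosed_of_isOpen _ hPo
  have hPn (k : ℕ) : (P.map (iterHom φ k)).Normal := map_iterHom_iterCore_normal hφ k
  have hanti := map_iterHom_antitone (map_iterCore_le φ)
  rw [← hPdef] at hanti
  have hP0 : P.map (iterHom φ 0) = P := by
    convert P.map_id
    ext x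
    exact iterHom_zero φ x
  have h0 : φ.range.index ≠ 0 := index_ne_zero_of_isOpen ho
  have h1 : φ.range.index ≠ 1 := fun h => hne (Subgroup.index_eq_one.1 h)
  have hindex (k : ℕ) : (P.map (iterHom φ k)).index = P.index * φ.range.index ^ k := by
    rw [Subgroup.index_map_of_injective _ (iterHom_injective hφ k), index_range_iterHom hφ]
  have hPkc (k : ℕ) : IsClosed (P.map (iterHom φ k) : Set H) :=
    isClosed_map_of_isClosed _ (iterHom_continuous hc k) hPc
  have hPi : P.index ≠ 0 := index_ne_zero_of_isOpen hPo
  have hPko (k : ℕ) : IsOpen (P.map (iterHom φ k) : Set H) :=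
    isOpen_of_isClosed_of_index_ne_zero (hPkc k) (by
      rw [hindex]; exact mul_ne_zero hPi (pow_ne_zero _ h0))
  -- A nontrivial intersection would be open, hence of finite index, while the indices in `hindex`
  -- grow without bound.
  have hbot : ⨅ k, P.map (iterHom φ k) = ⊥ := by
    by_contra hb
    have hDo := hH.isOpen_of_isClosed _ (Subgroup.normal_iInf_normal hPn)
      (by rw [Subgroup.coe_iInf]; exact isClosed_iInter hPkc) hb
    have hDi := index_ne_zero_of_isOpen hDo
    set D := ⨅ k, P.map (iterHom φ k)
    have hle := Nat.le_of_dvd (Nat.pos_of_ne_zero hDi)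
      (Subgroup.index_dvd_of_le (iInf_le (fun k => P.map (iterHom φ k)) D.index))
    rw [hindex] at hle
    have h2 : D.index < φ.range.index ^ D.index := Nat.lt_pow_self (by omega)
    have h3 := Nat.le_mul_of_pos_left (φ.range.index ^ D.index) (Nat.pos_of_ne_zero hPi)
    omega
  have hrel (j : ℕ) : (P.map (iterHom φ (j + 1))).relIndex (P.map (iterHom φ j)) =
      (P.map (iterHom φ 1)).relIndex P := by
    rw [← map_iterHom_map_iterHom, Subgroup.relIndex_map_map_of_injective _ _
      (iterHom_injective hφ j)]
  have hrel0 : (P.map (iterHom φ 1)).relIndex P ≠ 0 := fun h =>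
    index_ne_zero_of_isOpen (hPko 1) (Subgroup.index_eq_zero_of_relIndex_eq_zero h)
  have hex (j : ℕ) : ∃ f : H →* Equiv.Perm (Fin ((P.map (iterHom φ 1)).relIndex P)),
      ∀ x, x ∈ f.ker ↔ ∀ a ∈ P.map (iterHom φ j), ⁅x, a⁆ ∈ P.map (iterHom φ (j + 1)) := by
    rw [← hrel j]
    exact exists_ker_eq_centralizer _ _ (by rw [hrel]; exact hrel0)
  choose f hf using hex
  have hfo (j : ℕ) : IsOpen ((f j).ker : Set H) := by
    refine Subgroup.isOpen_mono (fun x hx => (hf j x).2 fun a _ => ?_) (hPko (j + 1))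
    rw [commutatorElement_def, mul_assoc, mul_assoc]
    exact mul_mem hx (by
      rw [← mul_assoc]
      exact (hPn (j + 1)).conj_mem _ (inv_mem hx) a)
  -- All sections have the same order, so there are only finitely many distinct `f j`, and the
  -- intersection of their open kernels is open.
  have hL : IsOpen ((⨅ j, (f j).ker : Subgroup H) : Set H) := by
    have hfin : (Set.range f).Finite :=
      (finite_setOf_isOpen_ker hfg _).subset (by rintro _ ⟨j, rfl⟩; exact hfo j)
    have : ((⨅ j, (f j).ker : Subgroup H) : Set H) = ⋂ g ∈ Set.range f, (g.ker : Set H) := by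
      rw [Subgroup.coe_iInf, Set.biInter_range]
    rw [this]
    exact hfin.isOpen_biInter (by rintro _ ⟨j, rfl⟩; exact hfo j)
  -- a commutator bound for a deep term of the filtration yields one for `P` itself
  have hpull (k n : ℕ) (h : ∀ i, ⁅P.map (iterHom φ k), P.map (iterHom φ i)⁆ ≤
      P.map (iterHom φ (i + n))) (i : ℕ) : ⁅P, P.map (iterHom φ i)⁆ ≤ P.map (iterHom φ (i + n)) := by
    have := h (k + i)
    rw [← map_iterHom_map_iterHom φ P k i, ← Subgroup.map_commutator, add_assoc,
      ← map_iterHom_map_iterHom φ P k (i + n),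
      Subgroup.map_le_map_iff_of_injective (iterHom_injective hφ k)] at this
    exact this
  -- `L` contains some `φ^[k] P`, which therefore centralizes every section; injectivity of `φ^[k]`
  -- transfers this to `P`.
  have hone : ∀ i, ⁅P, P.map (iterHom φ i)⁆ ≤ P.map (iterHom φ (i + 1)) := by
    obtain ⟨k, hk⟩ := exists_le_of_iInf_le hanti.directed_ge hPkc hL (hbot ▸ bot_le)
    refine hpull k 1 fun i => Subgroup.commutator_le.2 fun x hx a ha => ?_
    exact (hf i x).1 (Subgroup.mem_iInf.1 (hk hx) i) a ha
  have : P.Normal := iterCore_normal φ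
  by_cases hcomm : ⁅P, P⁆ = ⊥
  · refine ⟨⟨P, hPo⟩, fun a ha b hb => ?_⟩
    have := Subgroup.commutator_mem_commutator ha hb
    rw [hcomm, Subgroup.mem_bot, commutatorElement_eq_one_iff_mul_comm] at this
    exact this
  exfalso
  have hCo : IsOpen (⁅P, P⁆.topologicalClosure : Set H) :=
    hH.isOpen_of_isClosed _ (Subgroup.is_normal_topologicalClosure _)
      (Subgroup.isClosed_topologicalClosure _)
      fun h => hcomm (le_bot_iff.1 (h ▸ Subgroup.le_topologicalClosure _))
  obtain ⟨k, hk⟩ := exists_le_of_iInf_le hanti.directed_ge hPkc hCo (hbot ▸ bot_le)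
  -- The closure of `⁅P, P⁆` contains `φ^[k] P`. By the three subgroups lemma `⁅P, P⁆` moves the
  -- filtration one step deeper than the bound known for `P`, and `hpull` returns the improved bound
  -- to `P`. Iterating forces `⁅P, P⁆` into the trivial intersection.
  have hall : ∀ n i, ⁅P, P.map (iterHom φ i)⁆ ≤ P.map (iterHom φ (i + (n + 1))) := by
    intro n
    induction n with
    | zero => exact hone
    | succ n ih =>
      refine hpull k _ fun i => ?_
      refine (Subgroup.commutator_mono hk le_rfl).trans
        (commutator_topologicalClosure_le (hPkc _) ?_)
      have h3 : ⁅⁅P, P.map (iterHom φ i)⁆, P⁆ ≤ P.map (iterHom φ (i + (n + 1 + 1))) := by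
        rw [Subgroup.commutator_comm]
        exact (Subgroup.commutator_mono le_rfl (ih i)).trans
          (hone (i + (n + 1)))
      refine commutator_commutator_le_of_rotate h3 ?_
      rwa [Subgroup.commutator_comm (P.map (iterHom φ i)) P]
  refine hcomm (le_bot_iff.1 (hbot ▸ le_iInf fun n => ?_))
  have := hall n 0
  rw [hP0, zero_add] at this
  exact this.trans (hanti n.le_succ)

end SelfEmbedding

/-! ### Non-isomorphic open subgroups -/

section Sequences

/-- A group that is hereditarily just infinite, of finite lower rank and not virtually abelian has
arbitrarily small open subgroups of small rank that are pairwise non-isomorphic. -/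
theorem exists_seq_nonisomorphic {G : Type*} [Group G] [TopologicalSpace G] [IsTopologicalGroup G]
    [CompactSpace G] [T2Space G] [TotallyDisconnectedSpace G]
    (hG : IsHereditarilyJustInfinite G) (hfin : lowerRank G < ⊤) (hna : ¬ IsVirtuallyAbelian G)
    (U : OpenSubgroup G) :
    ∃ s : ℕ → OpenSubgroup G, (∀ k, s k ≤ U) ∧
      (∀ k, topRank (s k).toSubgroup ≤ lowerRank G) ∧
      ∀ j k, j ≠ k → IsEmpty ((s j).toSubgroup ≃ₜ* (s k).toSubgroup) := by
  have := hG.infinite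
  have hstep (V : OpenSubgroup G) : ∃ W < V, topRank W.toSubgroup ≤ lowerRank G := by
    obtain ⟨V', hV'⟩ := exists_openSubgroup_lt V
    obtain ⟨W, hW, hr⟩ := exists_topRank_le_lowerRank hfin V'
    exact ⟨W, hW.trans_lt hV', hr⟩
  choose f hf hfr using hstep
  have hs (k : ℕ) : f^[k + 2] U < f^[k + 1] U := by
    rw [Function.iterate_succ_apply' f (k + 1)]
    exact hf _
  have hanti : StrictAnti fun k => f^[k + 1] U := strictAnti_nat_of_succ_lt hs
  have hr (k : ℕ) : topRank (f^[k + 1] U).toSubgroup ≤ lowerRank G := by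
    rw [Function.iterate_succ_apply']
    exact hfr _
  have hlt (j k : ℕ) (hjk : j < k) :
      IsEmpty ((f^[j + 1] U).toSubgroup ≃ₜ* (f^[k + 1] U).toSubgroup) := by
    refine ⟨fun e => hna ?_⟩
    set A := f^[j + 1] U
    set B := f^[k + 1] U
    have hBA : B < A := hanti hjk
    have : CompactSpace A.toSubgroup := isCompact_iff_compactSpace.1 A.isClosed.isCompact
    -- The isomorphism onto the smaller term, followed by inclusion, is a proper open self-embedding
    -- of `A`.
    let φ : A.toSubgroup →* A.toSubgroup :=
      (Subgroup.inclusion (H := B.toSubgroup) (K := A.toSubgroup) hBA.le).comp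
        e.toMulEquiv.toMonoidHom
    have hrange : φ.range = B.toSubgroup.subgroupOf A.toSubgroup := by
      ext x
      constructor
      · rintro ⟨y, rfl⟩
        exact (e y).2
      · intro hx
        exact ⟨e.symm ⟨x, hx⟩, Subtype.ext (congrArg (fun z : B.toSubgroup => (z : G)) (e.apply_symm_apply ⟨x, hx⟩))⟩
    refine IsVirtuallyAbelian.of_openSubgroup (U := A) (isVirtuallyAbelian_of_self_embedding
      (hG A) ((hr j).trans_lt hfin) (φ := φ)
      ((Subgroup.inclusion_injective hBA.le).comp e.injective)
      ((continuous_inclusion hBA.le).comp e.continuous) ?_ ?_)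
    · rw [hrange]
      exact B.isOpen.preimage continuous_subtype_val
    · rw [hrange, Ne, Subgroup.subgroupOf_eq_top]
      exact fun h => not_lt_of_ge h hBA
  refine ⟨fun k => f^[k + 1] U, fun k => ?_, hr, fun j k hjk => ?_⟩
  · exact (hanti.antitone (Nat.zero_le k)).trans (hf U).le
  · rcases lt_or_gt_of_ne hjk with h | h
    · exact hlt j k h
    · exact ⟨fun e => (hlt k j h).false e.symm⟩

/-- From finitely many sequences, each consisting of pairwise inequivalent terms, one can choose
terms that are pairwise inequivalent. -/
theorem exists_choice_inequivalent {ι X : Type*} [Finite ι] (r : Setoid X) (s : ι → ℕ → X)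
    (hs : ∀ i j k, j ≠ k → ¬ r (s i j) (s i k)) :
    ∃ c : ι → ℕ, ∀ i l, i ≠ l → ¬ r (s i (c i)) (s l (c l)) := by
  classical
  have := Fintype.ofFinite ι
  suffices h : ∀ t : Finset ι, ∃ c : ι → ℕ, ∀ i ∈ t, ∀ l ∈ t, i ≠ l →
      ¬ r (s i (c i)) (s l (c l)) by
    obtain ⟨c, hc⟩ := h Finset.univ
    exact ⟨c, fun i l => hc i (Finset.mem_univ _) l (Finset.mem_univ _)⟩
  intro t
  induction t using Finset.induction_on with
  | empty => exact ⟨fun _ => 0, by simp⟩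
  | insert a t ha ih =>
    obtain ⟨c, hc⟩ := ih
    have hbad : {k | ∃ i ∈ t, r (s a k) (s i (c i))}.Finite := by
      have : {k | ∃ i ∈ t, r (s a k) (s i (c i))} = ⋃ i ∈ t, {k | r (s a k) (s i (c i))} := by
        ext k
        simp
      rw [this]
      refine t.finite_toSet.biUnion fun i _ => Set.Subsingleton.finite fun j hj k hk => ?_
      by_contra hjk
      exact hs a j k hjk (r.trans hj (r.symm hk))
    obtain ⟨k, hk⟩ := hbad.infinite_compl.nonempty
    simp only [Set.mem_compl_iff, Set.mem_ofPred_eq, not_exists, not_and] at hk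
    have hne {i : ι} (hi : i ∈ t) : i ≠ a := fun h => ha (h ▸ hi)
    refine ⟨Function.update c a k, fun i hi l hl hil => ?_⟩
    rcases Finset.mem_insert.1 hi with rfl | hi' <;>
      rcases Finset.mem_insert.1 hl with rfl | hl'
    · exact absurd rfl hil
    · simpa [Function.update_of_ne (hne hl')] using hk l hl'
    · simpa [Function.update_of_ne (hne hi')] using fun h => hk i hi' (r.symm h)
    · simpa [Function.update_of_ne (hne hi'), Function.update_of_ne (hne hl')] using hc i hi' l hl' hil

theorem exists_pairwise_nonisomorphic {ι : Type*} [Finite ι] {G : ι → Type*}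
    [∀ i, Group (G i)] [∀ i, TopologicalSpace (G i)] [∀ i, IsTopologicalGroup (G i)]
    [∀ i, CompactSpace (G i)] [∀ i, T2Space (G i)] [∀ i, TotallyDisconnectedSpace (G i)]
    (hG : ∀ i, IsHereditarilyJustInfinite (G i)) (hfin : ∀ i, lowerRank (G i) < ⊤)
    (hna : ∀ i, ¬ IsVirtuallyAbelian (G i)) (U : ∀ i, OpenSubgroup (G i)) :
    ∃ H : ∀ i, OpenSubgroup (G i), (∀ i, H i ≤ U i) ∧
      (∀ i, topRank (H i).toSubgroup ≤ lowerRank (G i)) ∧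
      ∀ i l, i ≠ l → IsEmpty ((H i).toSubgroup ≃ₜ* (H l).toSubgroup) := by
  choose s hsU hsr hs using
    fun i => exists_seq_nonisomorphic (hG i) (hfin i) (hna i) (U i)
  let r : Setoid (Σ i, OpenSubgroup (G i)) :=
    { r := fun x y => Nonempty (x.2.toSubgroup ≃ₜ* y.2.toSubgroup)
      iseqv := ⟨fun _ => ⟨ContinuousMulEquiv.refl _⟩, fun ⟨e⟩ => ⟨e.symm⟩,
        fun ⟨e⟩ ⟨f⟩ => ⟨e.trans f⟩⟩ }
  obtain ⟨c, hc⟩ := exists_choice_inequivalent r (fun i k => ⟨i, s i k⟩)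
    fun i j k hjk ⟨e⟩ => (hs i j k hjk).false e
  exact ⟨fun i => s i (c i), fun i => hsU i _, fun i => hsr i _,
    fun i l hil => not_nonempty_iff.1 (hc i l hil)⟩

end Sequences

/-! ### Subdirect products -/

section Subdirect

/-- Two continuous surjective homomorphisms from a compact group with the same kernel have
isomorphic images. -/
theorem nonempty_continuousMulEquiv_of_ker_eq {K X Y : Type*} [Group K] [TopologicalSpace K]
    [CompactSpace K] [Group X] [TopologicalSpace X] [T2Space X] [Group Y] [TopologicalSpace Y]
    [T2Space Y] (a : K →* X) (b : K →* Y) (ha : Continuous a) (hb : Continuous b)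
    (hsa : Function.Surjective a) (hsb : Function.Surjective b) (hker : a.ker = b.ker) :
    Nonempty (X ≃ₜ* Y) := by
  let e : X ≃* Y := ((QuotientGroup.quotientKerEquivOfSurjective a hsa).symm.trans
    (QuotientGroup.quotientMulEquivOfEq hker)).trans
    (QuotientGroup.quotientKerEquivOfSurjective b hsb)
  have he (k : K) : e (a k) = b k := by
    have : (QuotientGroup.quotientKerEquivOfSurjective a hsa).symm (a k) = (k : K ⧸ a.ker) := by
      rw [MulEquiv.symm_apply_eq]
      rfl
    simp only [e, MulEquiv.trans_apply, this]
    rfl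
  have he' (k : K) : e.symm (b k) = a k := by rw [← he, e.symm_apply_apply]
  refine ⟨{ e with continuous_toFun := ?_, continuous_invFun := ?_ }⟩
  · change Continuous e
    rw [(Topology.IsQuotientMap.of_surjective_continuous hsa ha).continuous_iff]
    exact hb.congr fun k => (he k).symm
  · change Continuous e.symm
    rw [(Topology.IsQuotientMap.of_surjective_continuous hsb hb).continuous_iff]
    exact ha.congr fun k => (he' k).symm

variable {ι : Type*} {G : ι → Type*} [∀ i, Group (G i)]

/-- The `i`-th coordinates of those elements of `K` whose coordinates in `J` are trivial. -/
def coordSubgroup (K : Subgroup (∀ i, G i)) (i : ι) (J : Set ι) : Subgroup (G i) :=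
  (K ⊓ Subgroup.pi J fun _ => ⊥).map (Pi.evalMonoidHom G i)

theorem mem_coordSubgroup {K : Subgroup (∀ i, G i)} {i : ι} {J : Set ι} {x : G i} :
    x ∈ coordSubgroup K i J ↔ ∃ g ∈ K, (∀ l ∈ J, g l = 1) ∧ g i = x := by
  simp [coordSubgroup, Subgroup.mem_pi, and_assoc]

theorem coordSubgroup_le {K : Subgroup (∀ i, G i)} {i : ι} {J : Set ι} :
    coordSubgroup K i J ≤ K.map (Pi.evalMonoidHom G i) :=
  Subgroup.map_mono inf_le_left

theorem conj_mem_coordSubgroup {K : Subgroup (∀ i, G i)} {i : ι} {J : Set ι} {u x : G i}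
    (hu : u ∈ K.map (Pi.evalMonoidHom G i)) (hx : x ∈ coordSubgroup K i J) :
    u * x * u⁻¹ ∈ coordSubgroup K i J := by
  obtain ⟨k, hk, rfl⟩ := hu
  obtain ⟨g, hg, hgJ, rfl⟩ := mem_coordSubgroup.1 hx
  exact mem_coordSubgroup.2 ⟨k * g * k⁻¹, mul_mem (mul_mem hk hg) (inv_mem hk),
    fun l hl => by simp [hgJ l hl], rfl⟩

/-- The commutator of an element trivial on `J` with one trivial on `J'` is trivial on both. -/
theorem commute_of_coordSubgroup_union_eq_bot {K : Subgroup (∀ i, G i)} {i : ι} {J J' : Set ι}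
    (h : coordSubgroup K i (J ∪ J') = ⊥) {x y : G i} (hx : x ∈ coordSubgroup K i J)
    (hy : y ∈ coordSubgroup K i J') : x * y = y * x := by
  obtain ⟨g, hg, hgJ, rfl⟩ := mem_coordSubgroup.1 hx
  obtain ⟨k, hk, hkJ, rfl⟩ := mem_coordSubgroup.1 hy
  rw [← commutatorElement_eq_one_iff_mul_comm, ← Subgroup.mem_bot, ← h]
  refine mem_coordSubgroup.2 ⟨⁅g, k⁆, ?_, ?_, rfl⟩
  · exact mul_mem (mul_mem (mul_mem hg hk) (inv_mem hg)) (inv_mem hk)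
  · rintro l (hl | hl)
    · simp [commutatorElement_def, hgJ l hl]
    · simp [commutatorElement_def, hkJ l hl]

theorem eq_one_of_coordSubgroup_eq_bot {K : Subgroup (∀ i, G i)} {i : ι} {J : Set ι}
    (h : coordSubgroup K i J = ⊥) {g : ∀ i, G i} (hg : g ∈ K) (hgJ : ∀ l ∈ J, g l = 1) :
    g i = 1 := by
  rw [← Subgroup.mem_bot, ← h]
  exact mem_coordSubgroup.2 ⟨g, hg, hgJ, rfl⟩

theorem mulSingle_mem_of_mem_coordSubgroup [DecidableEq ι] {K : Subgroup (∀ i, G i)} {i : ι}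
    {x : G i} (hx : x ∈ coordSubgroup K i {i}ᶜ) : Pi.mulSingle i x ∈ K := by
  obtain ⟨g, hg, hgJ, rfl⟩ := mem_coordSubgroup.1 hx
  convert hg
  ext l
  by_cases hl : l = i
  · subst hl
    simp
  · rw [Pi.mulSingle_eq_of_ne hl, hgJ l hl]

variable [∀ i, TopologicalSpace (G i)] [∀ i, CompactSpace (G i)] [∀ i, T2Space (G i)]

theorem isClosed_coordSubgroup {K : Subgroup (∀ i, G i)} (hK : IsClosed (K : Set (∀ i, G i)))
    (i : ι) (J : Set ι) : IsClosed (coordSubgroup K i J : Set (G i)) := by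
  refine isClosed_map_of_isClosed _ (continuous_apply i) ?_
  rw [Subgroup.coe_inf, Subgroup.coe_pi]
  exact hK.inter (isClosed_set_pi fun l _ => by
    rw [Subgroup.coe_bot]; exact isClosed_singleton)

theorem isOpen_coordSubgroup (hG : ∀ i, IsHereditarilyJustInfinite (G i))
    {K : Subgroup (∀ i, G i)} (hK : IsClosed (K : Set (∀ i, G i))) {H : ∀ i, OpenSubgroup (G i)}
    (hKH : ∀ i, K.map (Pi.evalMonoidHom G i) = (H i).toSubgroup) {i : ι} {J : Set ι}
    (hne : coordSubgroup K i J ≠ ⊥) : IsOpen (coordSubgroup K i J : Set (G i)) :=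
  (hG i).isOpen (H i) (hKH i ▸ coordSubgroup_le)
    (fun u hu x hx => conj_mem_coordSubgroup (by rw [hKH i]; exact hu) hx)
    (isClosed_coordSubgroup hK i J) hne

variable [∀ i, IsTopologicalGroup (G i)]

/-- Goursat's argument: if this subgroup is trivial, so is the one with `i` and `l` exchanged. Then
the two projections of `K` have the same kernel and their images are isomorphic. -/
theorem coordSubgroup_singleton_ne_bot (hG : ∀ i, IsHereditarilyJustInfinite (G i))
    {K : Subgroup (∀ i, G i)} (hK : IsClosed (K : Set (∀ i, G i))) {H : ∀ i, OpenSubgroup (G i)}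
    (hKH : ∀ i, K.map (Pi.evalMonoidHom G i) = (H i).toSubgroup) {i l : ι}
    (hiso : IsEmpty ((H i).toSubgroup ≃ₜ* (H l).toSubgroup)) : coordSubgroup K i {l} ≠ ⊥ := by
  intro hbot
  have h1 {g : ∀ i, G i} (hg : g ∈ K) (hgl : g l = 1) : g i = 1 :=
    eq_one_of_coordSubgroup_eq_bot hbot hg (by simpa using hgl)
  have hex (x : (H i).toSubgroup) : ∃ g ∈ K, g i = x := (hKH i).ge x.2
  have hbot' : coordSubgroup K l {i} = ⊥ := by
    by_contra hne
    have := Subgroup.quotient_finite_of_isOpen _ (isOpen_coordSubgroup hG hK hKH hne)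
    choose g hg hgi using hex
    -- Otherwise the exchanged subgroup is open, of finite index in `G l`, and the infinite group `H
    -- i` would inject into a finite coset space.
    have hinj : Function.Injective
        fun x : (H i).toSubgroup => (g x l : G l ⧸ coordSubgroup K l {i}) := by
      intro x y hxy
      obtain ⟨k, hk, hki, hkl⟩ := mem_coordSubgroup.1 (QuotientGroup.eq.1 hxy)
      have := h1 (mul_mem (inv_mem hk) (mul_mem (inv_mem (hg x)) (hg y)))
        (by simp [hkl])
      simp only [Pi.mul_apply, Pi.inv_apply, hki i rfl, hgi] at this
      rw [inv_one, one_mul, inv_mul_eq_one] at this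
      exact Subtype.ext this
    have := Finite.of_injective _ hinj
    have := (hG i).infinite_openSubgroup (H i)
    exact not_finite (H i).toSubgroup
  have h2 {g : ∀ i, G i} (hg : g ∈ K) (hgi : g i = 1) : g l = 1 :=
    eq_one_of_coordSubgroup_eq_bot hbot' hg (by simpa using hgi)
  have hmem (m : ι) (g : K) : Pi.evalMonoidHom G m g ∈ (H m).toSubgroup :=
    hKH m ▸ Subgroup.mem_map_of_mem _ g.2
  let a (m : ι) : K →* (H m).toSubgroup :=
    ((Pi.evalMonoidHom G m).comp K.subtype).codRestrict _ (hmem m)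
  have ha (m : ι) : Continuous (a m) :=
    ((continuous_apply m).comp continuous_subtype_val).subtype_mk _
  have hs (m : ι) : Function.Surjective (a m) := by
    rintro ⟨x, hx⟩
    rw [← hKH m] at hx
    obtain ⟨g, hg, rfl⟩ := hx
    exact ⟨⟨g, hg⟩, rfl⟩
  have : CompactSpace K := isCompact_iff_compactSpace.1 hK.isCompact
  obtain ⟨e⟩ := nonempty_continuousMulEquiv_of_ker_eq (a i) (a l) (ha i) (ha l) (hs i) (hs l) (by
    ext g
    simp only [MonoidHom.mem_ker, Subtype.ext_iff]
    exact ⟨h2 g.2, h1 g.2⟩)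
  exact hiso.false e

/-- Coordinates are added to `J` one at a time. Triviality at the next stage would make two open
subgroups commute elementwise, and their intersection would be open and abelian. -/
theorem coordSubgroup_ne_bot (hG : ∀ i, IsHereditarilyJustInfinite (G i))
    {K : Subgroup (∀ i, G i)} (hK : IsClosed (K : Set (∀ i, G i))) {H : ∀ i, OpenSubgroup (G i)}
    (hKH : ∀ i, K.map (Pi.evalMonoidHom G i) = (H i).toSubgroup) {i : ι}
    (hna : ¬ IsVirtuallyAbelian (G i))
    (hiso : ∀ l, l ≠ i → IsEmpty ((H i).toSubgroup ≃ₜ* (H l).toSubgroup))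
    (J : Finset ι) (hiJ : i ∉ J) : coordSubgroup K i J ≠ ⊥ := by
  classical
  induction J using Finset.induction_on with
  | empty =>
    have : coordSubgroup K i ((∅ : Finset ι) : Set ι) = (H i).toSubgroup := by
      rw [← hKH i]
      ext x
      simp [mem_coordSubgroup]
    rw [this]
    intro h
    have := (hG i).infinite_openSubgroup (H i)
    rw [h] at this
    exact not_finite (⊥ : Subgroup (G i))
  | insert l J hlJ ih =>
    simp only [Finset.mem_insert, not_or] at hiJ
    have h1 := isOpen_coordSubgroup hG hK hKH (ih hiJ.2)
    have h2 := isOpen_coordSubgroup hG hK hKH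
      (coordSubgroup_singleton_ne_bot hG hK hKH (hiso l (Ne.symm hiJ.1)))
    intro h
    rw [Finset.coe_insert, Set.insert_eq] at h
    refine hna ⟨⟨coordSubgroup K i {l} ⊓ coordSubgroup K i J, h2.inter h1⟩, fun a ha b hb => ?_⟩
    exact commute_of_coordSubgroup_union_eq_bot h ha.1 hb.2

/-- A closed subdirect subgroup of a product of open subgroups of hereditarily just infinite groups
is open if the factors that are not virtually abelian are pairwise non-isomorphic and the subgroup
projects onto elements of infinite order in each of the other factors. -/
theorem isOpen_of_subdirect [Finite ι] (hG : ∀ i, IsHereditarilyJustInfinite (G i))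
    {K : Subgroup (∀ i, G i)} (hK : IsClosed (K : Set (∀ i, G i))) {H : ∀ i, OpenSubgroup (G i)}
    (hKH : ∀ i, K.map (Pi.evalMonoidHom G i) = (H i).toSubgroup)
    (hiso : ∀ i, ¬ IsVirtuallyAbelian (G i) → ∀ l, l ≠ i →
      IsEmpty ((H i).toSubgroup ≃ₜ* (H l).toSubgroup))
    (hva : ∀ i, IsVirtuallyAbelian (G i) → ∃ k ∈ K, (∀ s, s ≠ 0 → k i ^ s ≠ 1) ∧
      ∀ l, IsVirtuallyAbelian (G l) → l ≠ i → k l = 1) :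
    IsOpen (K : Set (∀ i, G i)) := by
  classical
  have := Fintype.ofFinite ι
  have hna (i : ι) (hi : ¬ IsVirtuallyAbelian (G i)) : coordSubgroup K i {i}ᶜ ≠ ⊥ := by
    have := coordSubgroup_ne_bot hG hK hKH hi (hiso i hi) {i}ᶜ (by simp)
    rwa [Finset.coe_compl, Finset.coe_singleton] at this
  have hne (i : ι) : coordSubgroup K i {i}ᶜ ≠ ⊥ := by
    by_cases hi : IsVirtuallyAbelian (G i)
    swap
    · exact hna i hi
    obtain ⟨k, hk, hki, hkl⟩ := hva i hi
    have hpow (l : ι) : ∃ s, s ≠ 0 ∧ (¬ IsVirtuallyAbelian (G l) →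
        k l ^ s ∈ coordSubgroup K l {l}ᶜ) := by
      by_cases hl : IsVirtuallyAbelian (G l)
      · exact ⟨1, one_ne_zero, fun h => absurd hl h⟩
      · obtain ⟨s, hs, -, hmem⟩ := Subgroup.exists_pow_mem_of_index_ne_zero
          (index_ne_zero_of_isOpen (isOpen_coordSubgroup hG hK hKH (hna l hl))) (k l)
        exact ⟨s, hs.ne', fun _ => hmem⟩
    choose s hs0 hs using hpow
    -- A common exponent that carries every coordinate of `k` in a factor that is not virtually
    -- abelian into the part of `K` inside that factor. Dividing `k ^ S` by those coordinates,
    -- collected in `m`, leaves an element of `K` supported at `i`, with entry `k i ^ S ≠ 1`.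
    set S := ∏ l, s l
    have hS0 : S ≠ 0 := Finset.prod_ne_zero_iff.2 fun l _ => hs0 l
    have hS (l : ι) (hl : ¬ IsVirtuallyAbelian (G l)) : k l ^ S ∈ coordSubgroup K l {l}ᶜ := by
      obtain ⟨t, ht⟩ := Finset.dvd_prod_of_mem s (Finset.mem_univ l)
      change k l ^ (∏ l, s l) ∈ _
      rw [ht, pow_mul]
      exact pow_mem (hs l hl) t
    let m : ∀ l, G l := fun l => if IsVirtuallyAbelian (G l) then 1 else k l ^ S
    have hm : m ∈ K := by
      have hle : Subgroup.pi Set.univ (fun l =>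
          if IsVirtuallyAbelian (G l) then (⊥ : Subgroup (G l)) else coordSubgroup K l {l}ᶜ) ≤ K := by
        rw [Subgroup.pi_le_iff]
        intro l
        split_ifs
        · simp
        · rintro _ ⟨x, hx, rfl⟩
          exact mulSingle_mem_of_mem_coordSubgroup hx
      refine hle fun l _ => ?_
      by_cases hl : IsVirtuallyAbelian (G l)
      · simp [m, hl]
      · simpa [m, hl] using hS l hl
    intro hbot
    have h1 := eq_one_of_coordSubgroup_eq_bot hbot (mul_mem (pow_mem hk S) (inv_mem hm)) (by
      intro l hl
      by_cases hl' : IsVirtuallyAbelian (G l)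
      · simp [m, hl', hkl l hl' hl]
      · simp [m, hl'])
    simp only [m, Pi.mul_apply, Pi.pow_apply, Pi.inv_apply, if_pos hi, inv_one, mul_one] at h1
    exact hki S hS0 h1
  refine Subgroup.isOpen_mono (H₁ := Subgroup.pi Set.univ fun i => coordSubgroup K i {i}ᶜ) ?_ ?_
  · rw [Subgroup.pi_le_iff]
    rintro i _ ⟨x, hx, rfl⟩
    exact mulSingle_mem_of_mem_coordSubgroup hx
  · rw [Subgroup.coe_pi]
    exact isOpen_set_pi Set.finite_univ fun i _ => isOpen_coordSubgroup hG hK hKH (hne i)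

end Subdirect

/-! ### Abelian just infinite groups -/

section Abelian

variable {X : Type*} [CommGroup X] [TopologicalSpace X] [IsTopologicalGroup X] [CompactSpace X]
  [T2Space X]

theorem isClosed_range_pow (n : ℕ) : IsClosed ((powMonoidHom n : X →* X).range : Set X) := by
  rw [MonoidHom.coe_range]
  exact (isCompact_range (continuous_pow n)).isClosed

theorem range_pow_antitone {X : Type*} [CommGroup X] {m n : ℕ} (h : m ∣ n) :
    (powMonoidHom n : X →* X).range ≤ (powMonoidHom m : X →* X).range := by
  obtain ⟨k, rfl⟩ := h
  rintro _ ⟨x, rfl⟩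
  exact ⟨x ^ k, by simp [← pow_mul, mul_comm]⟩

theorem IsJustInfinite.isOpen_of_ne_bot {X : Type*} [CommGroup X] [TopologicalSpace X]
    (hX : IsJustInfinite X) {N : Subgroup X}
    (hc : IsClosed (N : Set X)) (hN : N ≠ ⊥) : IsOpen (N : Set X) :=
  hX.isOpen_of_isClosed N inferInstance hc hN

theorem IsJustInfinite.eq_one_of_pow_eq_one (hX : IsJustInfinite X) {x : X} {n : ℕ} (hn : n ≠ 0)
    (h : x ^ n = 1) : x = 1 := by
  by_contra hx
  have hfin : Finite (Subgroup.zpowers x) :=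
    finite_zpowers.2 (isOfFinOrder_iff_pow_eq_one.2 ⟨n, Nat.pos_of_ne_zero hn, h⟩)
  have hc : IsClosed (Subgroup.zpowers x : Set X) :=
    (Set.toFinite (Subgroup.zpowers x : Set X)).isClosed
  have := hX.infinite
  have := infinite_of_isOpen
    (hX.isOpen_of_ne_bot hc (fun h => hx (Subgroup.zpowers_eq_bot.1 h)))
  exact not_finite (Subgroup.zpowers x)

theorem pow_mem_of_range_pow_le {X : Type*} [CommGroup X] {n : ℕ} {N : Subgroup X}
    (h : (powMonoidHom n : X →* X).range ≤ N) (y : X ⧸ N) : y ^ n = 1 := by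
  induction y using QuotientGroup.induction_on with
  | H x =>
    rw [← QuotientGroup.mk_pow, QuotientGroup.eq_one_iff]
    exact h ⟨x, rfl⟩

theorem isProP_of_iInf_range_pow {p : ℕ} (hp : p.Prime)
    (h : ⨅ k : ℕ, (powMonoidHom (p ^ k) : X →* X).range = ⊥) : IsProP p X := by
  intro N
  have hanti : Antitone fun k : ℕ => (powMonoidHom (p ^ k) : X →* X).range :=
    fun j k hjk => range_pow_antitone (pow_dvd_pow p hjk)
  obtain ⟨k, hk⟩ := exists_le_of_iInf_le hanti.directed_ge
    (fun k => isClosed_range_pow _) N.isOpen' (h ▸ bot_le)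
  have : Fact p.Prime := ⟨hp⟩
  have : Finite (X ⧸ N.toSubgroup) := Subgroup.quotient_finite_of_isOpen _ N.isOpen'
  have hP : IsPGroup p (X ⧸ N.toSubgroup) := fun y => ⟨k, pow_mem_of_range_pow_le hk y⟩
  exact IsPGroup.iff_card.1 hP

variable [TotallyDisconnectedSpace X]

theorem eq_one_of_forall_mem_range_pow {X : Type*} [CommGroup X] [TopologicalSpace X]
    [IsTopologicalGroup X] [CompactSpace X] [TotallyDisconnectedSpace X] {x : X}
    (h : ∀ n : ℕ, n ≠ 0 → x ∈ (powMonoidHom n : X →* X).range) : x = 1 := by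
  by_contra hx
  obtain ⟨V, hV⟩ := exists_openNormalSubgroup_notMem hx
  have hV0 := index_ne_zero_of_isOpen V.isOpen'
  obtain ⟨y, rfl⟩ := h _ hV0
  exact hV (Subgroup.pow_index_mem V.toSubgroup y)

/-- An abelian just infinite profinite group is pro-`p` for some prime `p`. -/
theorem IsJustInfinite.exists_isProP (hX : IsJustInfinite X) : ∃ p : ℕ, p.Prime ∧ IsProP p X := by
  have := hX.infinite
  obtain ⟨x, hx⟩ := exists_ne (1 : X)
  obtain ⟨N, hN⟩ := exists_openNormalSubgroup_notMem hx
  have hN1 : N.toSubgroup.index ≠ 1 := fun h => hN (by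
    have : x ∈ N.toSubgroup := by rw [Subgroup.index_eq_one.1 h]; trivial
    exact this)
  obtain ⟨p, hp, hpN⟩ := Nat.exists_prime_and_dvd hN1
  refine ⟨p, hp, isProP_of_iInf_range_pow hp ?_⟩
  have : Fact p.Prime := ⟨hp⟩
  set T := ⨅ k : ℕ, (powMonoidHom (p ^ k) : X →* X).range
  let ι := {n : ℕ // n.Coprime p}
  have : Nonempty ι := ⟨⟨1, Nat.coprime_one_left p⟩⟩
  set Q := ⨅ n : ι, (powMonoidHom (n : ℕ) : X →* X).range
  have hTc : IsClosed (T : Set X) := by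
    rw [Subgroup.coe_iInf]
    exact isClosed_iInter fun _ => isClosed_range_pow _
  have hQc : IsClosed (Q : Set X) := by
    rw [Subgroup.coe_iInf]
    exact isClosed_iInter fun _ => isClosed_range_pow _
  -- An element of `Q ⊓ T` is an `n`-th power for every `n ≠ 0`, by Bézout for the `p`-part of `n`
  -- and its complement. If `Q` and `T` were both nontrivial, their trivial intersection would be
  -- open in an infinite compact group.
  have hQT : Q ⊓ T = ⊥ := by
    rw [Subgroup.eq_bot_iff_forall]
    rintro x ⟨hxQ, hxT⟩
    refine eq_one_of_forall_mem_range_pow fun n hn => ?_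
    obtain ⟨k, m, hm, rfl⟩ := Nat.exists_eq_pow_mul_and_not_dvd hn p hp.ne_one
    have hco : Nat.Coprime m p := ((Nat.Prime.coprime_iff_not_dvd hp).2 hm).symm
    obtain ⟨y, hy⟩ := Subgroup.mem_iInf.1 hxQ ⟨m, hco⟩
    obtain ⟨z, hz⟩ := Subgroup.mem_iInf.1 hxT k
    have hco' : IsCoprime (m : ℤ) ((p ^ k : ℕ) : ℤ) :=
      Nat.isCoprime_iff_coprime.2 (hco.pow_right k)
    obtain ⟨u, v, huv⟩ := hco'
    simp only [powMonoidHom_apply] at hy hz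
    refine ⟨z ^ u * y ^ v, ?_⟩
    calc (z ^ u * y ^ v) ^ (p ^ k * m) = (z ^ (p ^ k)) ^ (u * m) * (y ^ m) ^ (v * (p ^ k : ℕ)) := by
          rw [mul_pow]
          simp only [← zpow_natCast, ← zpow_mul]
          congr 2 <;> push_cast <;> ring
      _ = x := by rw [hy, hz, ← zpow_add, huv, zpow_one]
  by_contra hT
  -- If `Q` were trivial, compactness would give `X / N` an exponent coprime to `p`, although `p`
  -- divides its order.
  have hQ : Q ≠ ⊥ := by
    intro hQ
    have hdir : Directed (· ≥ ·) fun n : ι => (powMonoidHom (n : ℕ) : X →* X).range := by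
      intro m n
      exact ⟨⟨m * n, Nat.Coprime.mul_left m.2 n.2⟩, range_pow_antitone (Nat.dvd_mul_right _ _),
        range_pow_antitone (Nat.dvd_mul_left _ _)⟩
    obtain ⟨n, hn⟩ := exists_le_of_iInf_le hdir (fun n => isClosed_range_pow _) N.isOpen'
      (hQ.le.trans bot_le)
    have : Finite (X ⧸ N.toSubgroup) := Subgroup.quotient_finite_of_isOpen _ N.isOpen'
    obtain ⟨y, hy⟩ := exists_prime_orderOf_dvd_card' (G := X ⧸ N.toSubgroup) p hpN
    have hdvd : p ∣ (n : ℕ) := by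
      have := orderOf_dvd_of_pow_eq_one (pow_mem_of_range_pow_le hn y)
      rwa [hy] at this
    exact (Nat.Prime.coprime_iff_not_dvd hp).1 n.2.symm hdvd
  have ho : IsOpen ((Q ⊓ T : Subgroup X) : Set X) :=
    (hX.isOpen_of_ne_bot hQc hQ).inter (hX.isOpen_of_ne_bot hTc hT)
  rw [hQT] at ho
  have := infinite_of_isOpen ho
  exact not_finite (⊥ : Subgroup X)

theorem IsJustInfinite.le_index_range_pow (hX : IsJustInfinite X) {p : ℕ} (hp : p.Prime)
    (hpX : IsProP p X) : (powMonoidHom p : X →* X).range.index ≠ 0 ∧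
      p ≤ (powMonoidHom p : X →* X).range.index := by
  have := hX.infinite
  obtain ⟨x, hx⟩ := exists_ne (1 : X)
  have hne : (powMonoidHom p : X →* X).range ≠ ⊥ := fun h => hx <|
    hX.eq_one_of_pow_eq_one hp.ne_zero <| by
      rw [← Subgroup.mem_bot, ← h]
      exact ⟨x, rfl⟩
  have ho := hX.isOpen_of_ne_bot (isClosed_range_pow p) hne
  refine ⟨index_ne_zero_of_isOpen ho, ?_⟩
  obtain ⟨k, hk⟩ := hpX ⟨⟨_, ho⟩, inferInstance⟩
  change (powMonoidHom p : X →* X).range.index = _ at hk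
  rw [hk]
  refine Nat.le_self_pow ?_ p
  -- Index `1` would make every element a `p ^ l`-th power for every `l`, so every element would lie
  -- in every open normal subgroup.
  rintro rfl
  rw [pow_zero, Subgroup.index_eq_one, MonoidHom.range_eq_top] at hk
  obtain ⟨N, hN⟩ := exists_openNormalSubgroup_notMem hx
  obtain ⟨l, hl⟩ := hpX N
  have hs : Function.Surjective fun x : X => x ^ p ^ l := by
    have := Function.Surjective.iterate (f := fun x : X => x ^ p) hk l
    rwa [pow_iterate] at this
  obtain ⟨y, rfl⟩ := hs x
  refine hN ?_
  have := Subgroup.pow_index_mem N.toSubgroup y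
  rwa [hl] at this

end Abelian

/-! ### Rank bounds from indices of power subgroups -/

section AbelianRank

theorem index_range_pow_pi {ι : Type*} [Fintype ι] {X : ι → Type*} [∀ i, CommGroup (X i)] (n : ℕ) :
    (powMonoidHom n : (∀ i, X i) →* ∀ i, X i).range.index =
      ∏ i, (powMonoidHom n : X i →* X i).range.index := by
  let f : (∀ i, X i) →* ∀ i, X i ⧸ (powMonoidHom n : X i →* X i).range :=
    MonoidHom.pi fun i => (QuotientGroup.mk' _).comp (Pi.evalMonoidHom X i)
  have hker : f.ker = (powMonoidHom n : (∀ i, X i) →* ∀ i, X i).range := by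
    ext x
    constructor
    · intro hx
      have h (i : ι) : ∃ y : X i, y ^ n = x i := by
        have := congrFun (MonoidHom.mem_ker.1 hx) i
        exact (QuotientGroup.eq_one_iff (x i)).1 this
      choose y hy using h
      exact ⟨y, funext hy⟩
    · rintro ⟨y, rfl⟩
      exact funext fun i => (QuotientGroup.eq_one_iff (y i ^ n)).2 ⟨y i, rfl⟩
  have hs : Function.Surjective f := by
    intro y
    choose x hx using fun i => QuotientGroup.mk'_surjective _ (y i)
    exact ⟨x, funext hx⟩
  rw [← hker, Subgroup.index_ker, MonoidHom.range_eq_top.2 hs,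
    Nat.card_congr Subgroup.topEquiv.toEquiv, Nat.card_pi]
  rfl

theorem le_topRank_of_pow_le_index {A : Type*} [CommGroup A] [TopologicalSpace A]
    [IsTopologicalGroup A] [T2Space A] {p k : ℕ} (hp : p.Prime)
    (hinj : Function.Injective (powMonoidHom p : A →* A))
    (h0 : (powMonoidHom p : A →* A).range.index ≠ 0)
    (hk : p ^ k ≤ (powMonoidHom p : A →* A).range.index) (H : Subgroup A) [CompactSpace H]
    (hH : H.index ≠ 0) : (k : ℕ∞) ≤ topRank H := by
  classical
  refine le_iInf₂ fun S hS => ?_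
  set R := (powMonoidHom p : H →* H).range
  have hmap : R.map H.subtype = H.map (powMonoidHom p) := by
    ext x
    constructor
    · rintro ⟨_, ⟨y, rfl⟩, rfl⟩
      exact ⟨y, y.2, rfl⟩
    · rintro ⟨y, hy, rfl⟩
      exact ⟨_, ⟨⟨y, hy⟩, rfl⟩, rfl⟩
  -- Compute the index in `A` of the `p`-th powers of `H` through `H` and through the `p`-th powers
  -- of `A`; injectivity makes the common factor `H.index` cancel.
  have hR : R.index = (powMonoidHom p : A →* A).range.index := by
    have h := congrArg Subgroup.index hmap
    rw [Subgroup.index_map_subtype, Subgroup.index_map_of_injective _ hinj, mul_comm] at h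
    exact Nat.eq_of_mul_eq_mul_left (Nat.pos_of_ne_zero hH) h
  have hRo : IsOpen (R : Set H) :=
    isOpen_of_isClosed_of_index_ne_zero (isClosed_range_pow p) (hR ▸ h0)
  have hsup : Subgroup.closure (S : Set H) ⊔ R = ⊤ := by
    have ho := Subgroup.isOpen_mono (le_sup_right (a := Subgroup.closure (S : Set H))) hRo
    exact top_le_iff.1 (hS ▸ Subgroup.topologicalClosure_minimal _ le_sup_left
      (Subgroup.isClosed_of_isOpen _ ho))
  have hgen : Subgroup.closure ((S.image (QuotientGroup.mk' R) : Finset (H ⧸ R)) : Set (H ⧸ R)) =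
      ⊤ := by
    have h := congrArg (Subgroup.map (QuotientGroup.mk' R)) hsup
    rw [Subgroup.map_sup, (Subgroup.map_eq_bot_iff R).2 (QuotientGroup.ker_mk' R).ge, sup_bot_eq,
      MonoidHom.map_closure,
      Subgroup.map_top_of_surjective _ (QuotientGroup.mk'_surjective R)] at h
    simpa using h
  have hFG : Group.FG (H ⧸ R) := Group.fg_iff.2 ⟨_, hgen, Finset.finite_toSet _⟩
  -- The quotient is abelian of exponent dividing `p`, so its order divides `p` to the power of its
  -- rank.
  have hdvd := card_dvd_exponent_pow_rank' (H ⧸ R) (n := p) (pow_mem_of_range_pow_le le_rfl)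
  have hle := Nat.le_of_dvd (pow_pos hp.pos _) hdvd
  have hcard : Nat.card (H ⧸ R) = (powMonoidHom p : A →* A).range.index := hR
  have hkr : k ≤ Group.rank (H ⧸ R) :=
    (Nat.pow_le_pow_iff_right hp.one_lt).1 ((hk.trans hcard.ge).trans hle)
  exact_mod_cast (hkr.trans (Group.rank_le hgen)).trans Finset.card_image_le

end AbelianRank

/-! ### Virtually `ℤ_p` groups -/

section VirtuallyZp

variable {G : Type*} [Group G] [TopologicalSpace G] [IsTopologicalGroup G]

theorem mul_comm_of_topologicalClosure_zpowers [T2Space G] {z : G} {a b : G}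
    (ha : a ∈ (Subgroup.zpowers z).topologicalClosure)
    (hb : b ∈ (Subgroup.zpowers z).topologicalClosure) : a * b = b * a := by
  let := Subgroup.commGroupTopologicalClosure (Subgroup.zpowers z) (by
    rintro ⟨_, m, rfl⟩ ⟨_, n, rfl⟩
    exact Subtype.ext ((Commute.refl z).zpow_zpow m n))
  exact congrArg Subtype.val (mul_comm (⟨a, ha⟩ : (Subgroup.zpowers z).topologicalClosure) ⟨b, hb⟩)

theorem IsProcyclic.mul_comm [T2Space G] (h : IsProcyclic G) (a b : G) : a * b = b * a := by
  obtain ⟨z, hz⟩ := h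
  exact mul_comm_of_topologicalClosure_zpowers (z := z) (by simp [hz]) (by simp [hz])

theorem exists_zpowers_closure_of_isProcyclic {B : Subgroup G} (hB : IsClosed (B : Set G))
    (h : IsProcyclic B) : ∃ z : G, (Subgroup.zpowers z).topologicalClosure = B := by
  obtain ⟨z, hz⟩ := h
  refine ⟨z, le_antisymm (Subgroup.topologicalClosure_minimal _
    (Subgroup.zpowers_le.2 z.2) hB) fun x hx => ?_⟩
  have hx' : (⟨x, hx⟩ : B) ∈ (Subgroup.zpowers z).topologicalClosure := by simp [hz]
  rw [← SetLike.mem_coe, Subgroup.topologicalClosure_coe] at hx' ⊢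
  have := image_closure_subset_closure_image continuous_subtype_val ⟨_, hx', rfl⟩
  rwa [← Subgroup.coe_subtype, ← Subgroup.coe_map, MonoidHom.map_zpowers] at this

theorem isProcyclic_topologicalClosure_zpowers (z : G) :
    IsProcyclic (Subgroup.zpowers z).topologicalClosure := by
  have hz : z ∈ (Subgroup.zpowers z).topologicalClosure :=
    Subgroup.le_topologicalClosure _ (Subgroup.mem_zpowers z)
  refine ⟨⟨z, hz⟩, top_le_iff.1 fun x _ => ?_⟩
  rw [← SetLike.mem_coe, Subgroup.topologicalClosure_coe, closure_subtype]
  have hx := x.2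
  rw [← SetLike.mem_coe, Subgroup.topologicalClosure_coe] at hx
  convert hx
  rw [← Subgroup.coe_subtype, ← Subgroup.coe_map, MonoidHom.map_zpowers]
  rfl

/-- Closures of cyclic subgroups of abelian open subgroups are open. -/
theorem IsHereditarilyJustInfinite.isOpen_zpowers_closure (hG : IsHereditarilyJustInfinite G)
    {A : OpenSubgroup G} (hA : ∀ a ∈ A, ∀ b ∈ A, a * b = b * a) {z : G} (hzA : z ∈ A)
    (hz : z ≠ 1) : IsOpen ((Subgroup.zpowers z).topologicalClosure : Set G) := by
  have hle : (Subgroup.zpowers z).topologicalClosure ≤ A.toSubgroup :=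
    Subgroup.topologicalClosure_minimal _ (Subgroup.zpowers_le.2 hzA) A.isClosed
  refine hG.isOpen A hle (fun u hu n hn => ?_) (Subgroup.isClosed_topologicalClosure _) ?_
  · rwa [hA u hu n (hle hn), mul_inv_cancel_right]
  · intro h
    refine hz (Subgroup.mem_bot.1 (h ▸ Subgroup.le_topologicalClosure _ (Subgroup.mem_zpowers z)))

variable [CompactSpace G] [T2Space G] [TotallyDisconnectedSpace G]

theorem IsHereditarilyJustInfinite.exists_isVirtuallyZp (hG : IsHereditarilyJustInfinite G)
    (hva : IsVirtuallyAbelian G) : ∃ p : ℕ, p.Prime ∧ IsVirtuallyZp p G := by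
  obtain ⟨A, hA⟩ := hva
  have := hG.infinite_openSubgroup A
  obtain ⟨⟨z, hzA⟩, hz⟩ := exists_ne (1 : A.toSubgroup)
  have ho := hG.isOpen_zpowers_closure hA hzA fun h => hz (Subtype.ext h)
  let B : OpenSubgroup G := ⟨(Subgroup.zpowers z).topologicalClosure, ho⟩
  let : CommGroup B.toSubgroup :=
    { (inferInstance : Group B.toSubgroup) with
      mul_comm := fun a b => Subtype.ext (mul_comm_of_topologicalClosure_zpowers a.2 b.2) }
  have : CompactSpace B.toSubgroup := isCompact_iff_compactSpace.1 B.isClosed.isCompact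
  obtain ⟨p, hp, hpB⟩ := (hG B).exists_isProP
  exact ⟨p, hp, B, hG.infinite_openSubgroup B, isProcyclic_topologicalClosure_zpowers z, hpB⟩

theorem IsHereditarilyJustInfinite.exists_procyclic (hG : IsHereditarilyJustInfinite G) {p : ℕ}
    (h : IsVirtuallyZp p G) (U : OpenSubgroup G) :
    ∃ (z : G) (H : OpenSubgroup G), H ≤ U ∧
      (Subgroup.zpowers z).topologicalClosure = H.toSubgroup ∧ (∀ s, s ≠ 0 → z ^ s ≠ 1) ∧
      ∀ V : OpenSubgroup G, ∃ k, z ^ p ^ k ∈ V := by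
  obtain ⟨B, hBinf, hBcyc, hBp⟩ := h
  obtain ⟨b, hb⟩ := exists_zpowers_closure_of_isProcyclic B.isClosed hBcyc
  have hcomm : ∀ x ∈ B, ∀ y ∈ B, x * y = y * x := fun x hx y hy =>
    mul_comm_of_topologicalClosure_zpowers (z := b) (by rw [hb]; exact hx) (by rw [hb]; exact hy)
  have hbB : b ∈ B := hb.le (Subgroup.le_topologicalClosure _ (Subgroup.mem_zpowers b))
  have hbinf : ¬ IsOfFinOrder b := by
    intro hfin
    have hc : IsClosed (Subgroup.zpowers b : Set G) := (finite_zpowers.2 hfin).isClosed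
    have : (Subgroup.zpowers b).topologicalClosure = Subgroup.zpowers b :=
      SetLike.coe_injective hc.closure_eq
    rw [this] at hb
    have hfin' : (B.toSubgroup : Set G).Finite := hb ▸ finite_zpowers.2 hfin
    exact hfin'.not_infinite (Set.infinite_coe_iff.1 hBinf)
  -- A power of the generator of `B` lying in `U`; the closed subgroup it generates is still open.
  obtain ⟨s, hs, -, hsU⟩ := Subgroup.exists_pow_mem_of_index_ne_zero
    (index_ne_zero_of_isOpen U.isOpen) b
  have hinf (t : ℕ) (ht : t ≠ 0) : (b ^ s) ^ t ≠ 1 := by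
    rw [← pow_mul]
    exact fun h => hbinf (isOfFinOrder_iff_pow_eq_one.2
      ⟨s * t, Nat.mul_pos hs (Nat.pos_of_ne_zero ht), h⟩)
  have ho := hG.isOpen_zpowers_closure hcomm (pow_mem hbB s) (by simpa using hinf 1 one_ne_zero)
  refine ⟨b ^ s, ⟨_, ho⟩, ?_, rfl, hinf, fun V => ?_⟩
  · exact Subgroup.topologicalClosure_minimal _ (Subgroup.zpowers_le.2 hsU) U.isClosed
  · have hN : (V.toSubgroup.subgroupOf B.toSubgroup).Normal := by
      refine ⟨fun n hn g => ?_⟩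
      have : g * n * g⁻¹ = n := by
        rw [mul_inv_eq_iff_eq_mul]
        exact Subtype.ext (hcomm _ g.2 _ n.2)
      rwa [this]
    obtain ⟨k, hk⟩ := hBp ⟨⟨V.toSubgroup.subgroupOf B.toSubgroup,
      V.isOpen.preimage continuous_subtype_val⟩, hN⟩
    change (V.toSubgroup.subgroupOf B.toSubgroup).index = _ at hk
    have := Subgroup.pow_index_mem (V.toSubgroup.subgroupOf B.toSubgroup) ⟨b, hbB⟩
    rw [hk, Subgroup.mem_subgroupOf] at this
    refine ⟨k, ?_⟩
    rw [← pow_mul, mul_comm, pow_mul]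
    exact pow_mem (show b ^ p ^ k ∈ V from this) s

end VirtuallyZp

/-! ### Lower bounds for the lower rank of a product -/

section LowerBounds

theorem lowerRank_le_lowerRank_pi {ι : Type*} {G : ι → Type*} [∀ i, Group (G i)]
    [∀ i, TopologicalSpace (G i)] [∀ i, IsTopologicalGroup (G i)] (i : ι) :
    lowerRank (G i) ≤ lowerRank (∀ i, G i) := by
  refine ENat.forall_natCast_le_iff_le.1 fun m hm => ?_
  obtain ⟨U, hU⟩ := exists_le_topRank hm
  refine le_lowerRank (U.comap (Pi.evalMonoidHom G i) (continuous_apply i)) fun H hH => ?_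
  let K : OpenSubgroup (G i) := ⟨H.toSubgroup.map (Pi.evalMonoidHom G i),
    isOpenMap_eval i _ H.isOpen⟩
  have hK : K ≤ U := by
    rintro _ ⟨x, hx, rfl⟩
    exact hH hx
  refine (hU K hK).trans (topRank_le_of_surjective
    ((Pi.evalMonoidHom G i).subgroupMap H.toSubgroup) ?_
    (MonoidHom.subgroupMap_surjective _ _))
  exact ((continuous_apply i).comp continuous_subtype_val).subtype_mk _

theorem encard_isVirtuallyZp_le_lowerRank {ι : Type*} [Finite ι] {G : ι → Type*}
    [∀ i, Group (G i)] [∀ i, TopologicalSpace (G i)] [∀ i, IsTopologicalGroup (G i)]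
    [∀ i, CompactSpace (G i)] [∀ i, T2Space (G i)] [∀ i, TotallyDisconnectedSpace (G i)]
    (hG : ∀ i, IsHereditarilyJustInfinite (G i)) {p : ℕ} (hp : p.Prime) :
    {i | IsVirtuallyZp p (G i)}.encard ≤ lowerRank (∀ i, G i) := by
  classical
  set I := {i | IsVirtuallyZp p (G i)}
  have := Fintype.ofFinite I
  choose B hBinf hBcyc hBp using fun i : I => (show IsVirtuallyZp p (G i) from i.2)
  let : ∀ i : I, CommGroup (B i).toSubgroup := fun i =>
    { (inferInstance : Group (B i).toSubgroup) with mul_comm := (hBcyc i).mul_comm }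
  have (i : I) : CompactSpace (B i).toSubgroup :=
    isCompact_iff_compactSpace.1 (B i).isClosed.isCompact
  have hX (i : I) : IsJustInfinite (B i).toSubgroup := hG i (B i)
  let U : OpenSubgroup (∀ i, G i) :=
    ⟨Subgroup.comap (MonoidHom.pi fun i : I => Pi.evalMonoidHom G i)
      (Subgroup.pi Set.univ fun i : I => (B i).toSubgroup), by
      refine IsOpen.preimage (f := fun (g : ∀ i, G i) (i : I) => g i) (by fun_prop) ?_
      rw [Subgroup.coe_pi]
      exact isOpen_set_pi Set.finite_univ fun i _ => (B i).isOpen⟩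
  have hU {g : ∀ i, G i} (hg : g ∈ U) (i : I) : g i ∈ (B i).toSubgroup := hg i trivial
  let F : U.toSubgroup →* ∀ i : I, (B i).toSubgroup :=
    MonoidHom.pi fun i => ((Pi.evalMonoidHom G i).comp U.toSubgroup.subtype).codRestrict
      (B i).toSubgroup fun g => hU g.2 i
  have hFc : Continuous F := continuous_pi fun i =>
    ((continuous_apply (i : ι)).comp continuous_subtype_val).subtype_mk _
  have hFs : Function.Surjective F := by
    intro y
    let g : ∀ i, G i := fun i => if h : i ∈ I then (y ⟨i, h⟩ : G i) else 1
    have hg (i : I) : g i = y i := by simp [g]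
    have hgU : g ∈ U := fun i _ => by
      change g i ∈ (B i).toSubgroup
      rw [hg]
      exact (y i).2
    exact ⟨⟨g, hgU⟩, funext fun i => Subtype.ext (hg i)⟩
  rw [show I.encard = (Fintype.card I : ℕ) by
    rw [← ENat.card_coe_set_eq, ENat.card_eq_coe_fintype_card]]
  refine le_lowerRank U fun H hH => ?_
  let f : H.toSubgroup →* ∀ i : I, (B i).toSubgroup :=
    F.comp (Subgroup.inclusion (K := U.toSubgroup) hH)
  have hfc : Continuous f := hFc.comp (continuous_inclusion hH)
  have hrange : f.range = (H.toSubgroup.subgroupOf U.toSubgroup).map F := by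
    ext y
    constructor
    · rintro ⟨x, rfl⟩
      exact ⟨⟨x, hH x.2⟩, x.2, rfl⟩
    · rintro ⟨x, hx, rfl⟩
      exact ⟨⟨x, hx⟩, rfl⟩
  have : CompactSpace H.toSubgroup := isCompact_iff_compactSpace.1 H.isClosed.isCompact
  have : CompactSpace U.toSubgroup := isCompact_iff_compactSpace.1 U.isClosed.isCompact
  have : CompactSpace f.range := isCompact_iff_compactSpace.1 (by
    rw [MonoidHom.coe_range]
    exact isCompact_range hfc)
  have hindex : f.range.index ≠ 0 := by
    have ho : IsOpen (H.toSubgroup.subgroupOf U.toSubgroup : Set U.toSubgroup) :=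
      H.isOpen.preimage continuous_subtype_val
    rw [hrange]
    exact ne_zero_of_dvd_ne_zero (index_ne_zero_of_isOpen ho) (Subgroup.index_map_dvd _ hFs)
  have hpow := index_range_pow_pi (X := fun i : I => (B i).toSubgroup) p
  refine (le_topRank_of_pow_le_index hp ?_ ?_ ?_ f.range hindex).trans
    (topRank_le_of_surjective f.rangeRestrict (hfc.subtype_mk _) f.rangeRestrict_surjective)
  · rw [injective_iff_map_eq_one]
    intro x hx
    exact funext fun i => (hX i).eq_one_of_pow_eq_one hp.ne_zero (congrFun hx i)
  · rw [hpow]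
    exact Finset.prod_ne_zero_iff.2 fun i _ => ((hX i).le_index_range_pow hp (hBp i)).1
  · rw [hpow, ← Finset.card_univ]
    exact Finset.pow_card_le_prod _ _ _ fun i _ => ((hX i).le_index_range_pow hp (hBp i)).2

end LowerBounds

/-! ### Generating open subgroups of a product -/

section Generators

theorem map_topologicalClosure {G G' : Type*} [Group G] [TopologicalSpace G] [IsTopologicalGroup G]
    [CompactSpace G] [Group G'] [TopologicalSpace G'] [IsTopologicalGroup G'] [T2Space G']
    (f : G →* G') (hf : Continuous f) (A : Subgroup G) :
    A.topologicalClosure.map f = (A.map f).topologicalClosure := by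
  apply SetLike.coe_injective
  simp only [Subgroup.coe_map, Subgroup.topologicalClosure_coe]
  exact (hf.isClosedMap.closure_image_eq_of_continuous hf _).symm

theorem topRank_topologicalClosure_le {G : Type*} [Group G] [TopologicalSpace G]
    [IsTopologicalGroup G] {m : ℕ} (g : Fin m → G) :
    topRank (Subgroup.closure (Set.range g)).topologicalClosure ≤ m := by
  have hg (j : Fin m) : g j ∈ (Subgroup.closure (Set.range g)).topologicalClosure :=
    Subgroup.le_topologicalClosure _ (Subgroup.subset_closure ⟨j, rfl⟩)
  refine topRank_le_of_range (fun j => ⟨g j, hg j⟩) (top_le_iff.1 fun x _ => ?_)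
  rw [← SetLike.mem_coe, Subgroup.topologicalClosure_coe, closure_subtype]
  have hx := x.2
  rw [← SetLike.mem_coe, Subgroup.topologicalClosure_coe] at hx
  convert hx
  rw [← Subgroup.coe_subtype, ← Subgroup.coe_map, MonoidHom.map_closure, ← Set.range_comp]
  rfl

theorem exists_range_closure_eq {G : Type*} [Group G] [TopologicalSpace G]
    [IsTopologicalGroup G] [CompactSpace G] [T2Space G] (H : OpenSubgroup G) {m : ℕ}
    (h : topRank H.toSubgroup ≤ m) :
    ∃ g : Fin m → G, (Subgroup.closure (Set.range g)).topologicalClosure = H.toSubgroup := by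
  obtain ⟨g, hg⟩ := exists_range_of_topRank_le h
  have : CompactSpace H.toSubgroup := isCompact_iff_compactSpace.1 H.isClosed.isCompact
  refine ⟨fun j => g j, ?_⟩
  have h := map_topologicalClosure H.toSubgroup.subtype continuous_subtype_val
    (Subgroup.closure (Set.range g))
  rw [hg, MonoidHom.map_closure, ← Set.range_comp, ← MonoidHom.range_eq_map,
    Subgroup.range_subtype] at h
  exact h.symm

theorem mem_of_forall_openNormalSubgroup {G : Type*} [Group G] [TopologicalSpace G]
    [IsTopologicalGroup G] [CompactSpace G] [TotallyDisconnectedSpace G] {L : Subgroup G}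
    (hL : IsClosed (L : Set G)) {t : G}
    (h : ∀ V : OpenNormalSubgroup G, ∃ x ∈ L, t⁻¹ * x ∈ V) : t ∈ L := by
  by_contra ht
  obtain ⟨V, hV⟩ := ProfiniteGrp.exist_openNormalSubgroup_sub_open_nhds_of_one
    (U := (fun y => t * y) ⁻¹' (L : Set G)ᶜ) (hL.isOpen_compl.preimage (by fun_prop)) (by simpa)
  obtain ⟨x, hx, hxV⟩ := h V
  exact hV hxV (by simpa using hx)

/-- In a product of groups, the closed subgroup generated by `w` contains the `i`-th component of
`w` if the other components are topologically of order coprime to it. -/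
theorem mulSingle_mem_of_coprime {ι : Type*} [Finite ι] [DecidableEq ι] {G : ι → Type*}
    [∀ i, Group (G i)] [∀ i, TopologicalSpace (G i)] [∀ i, IsTopologicalGroup (G i)]
    [∀ i, CompactSpace (G i)] [∀ i, TotallyDisconnectedSpace (G i)]
    {L : Subgroup (∀ i, G i)} (hL : IsClosed (L : Set (∀ i, G i))) {w : ∀ i, G i} (hw : w ∈ L)
    (p : ι → ℕ) (hp : ∀ i, (p i).Prime) (i : ι)
    (hpow : ∀ l, ∀ V : OpenSubgroup (G l), ∃ k, w l ^ p l ^ k ∈ V)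
    (hdist : ∀ l, l ≠ i → w l ≠ 1 → p l ≠ p i) : Pi.mulSingle i (w i) ∈ L := by
  have := Fintype.ofFinite ι
  refine mem_of_forall_openNormalSubgroup hL fun V => ?_
  let W (l : ι) : OpenSubgroup (G l) :=
    V.toOpenSubgroup.comap (MonoidHom.mulSingle G l) (continuous_mulSingle l)
  have hW : Subgroup.pi Set.univ (fun l => (W l).toSubgroup) ≤ V.toSubgroup := by
    rw [Subgroup.pi_le_iff]
    rintro l _ ⟨x, hx, rfl⟩
    exact hx
  choose k hk using fun l => hpow l (W l)
  classical
  let D : ℕ := ∏ l with l ≠ i ∧ w l ≠ 1, p l ^ k l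
  have hco : Nat.Coprime (p i ^ k i) D := Nat.Coprime.prod_right fun l hl => by
    obtain ⟨hli, hwl⟩ := (Finset.mem_filter.1 hl).2
    exact Nat.Coprime.pow _ _ ((Nat.coprime_primes (hp i) (hp l)).2 (hdist l hli hwl).symm)
  -- By Bézout, `v * D` is `1` modulo `p i ^ k i` and divisible by the other relevant prime powers,
  -- so modulo `V` the power `w ^ (v * D)` keeps the `i`-th component and kills the rest.
  obtain ⟨u, v, huv⟩ := Nat.isCoprime_iff_coprime.2 hco
  refine ⟨w ^ (v * D), zpow_mem hw _, hW fun l _ => ?_⟩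
  simp only [Pi.mul_apply, Pi.inv_apply, Pi.pow_apply]
  by_cases hl : l = i
  · subst hl
    have : (Pi.mulSingle l (w l) l)⁻¹ * w l ^ (v * D) = (w l ^ p l ^ k l) ^ (-u) := by
      rw [Pi.mulSingle_eq_same, ← zpow_natCast, ← zpow_mul, inv_mul_eq_iff_eq_mul,
        ← zpow_one_add]
      congr 1
      linear_combination huv
    rw [this]
    exact zpow_mem (hk l) _
  · rw [Pi.mulSingle_eq_of_ne hl, inv_one, one_mul]
    by_cases hwl : w l = 1
    · rw [hwl, one_zpow]
      exact one_mem (W l)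
    · have hdvd : p l ^ k l ∣ D :=
        Finset.dvd_prod_of_mem (fun l => p l ^ k l) (by simp [hl, hwl])
      obtain ⟨c, hc⟩ := hdvd
      rw [mul_comm v, zpow_mul, zpow_natCast, hc, pow_mul]
      exact zpow_mem (pow_mem (hk l) c) v

end Generators

/-! ### Assembling small open subgroups with few generators -/

section UpperBound

/-- Indices can be placed in `m` slots such that those sharing a slot have distinct labels, if each
label is used at most `m` times. -/
theorem exists_slots {ι : Type*} [Finite ι] (s : Set ι) (p : ι → ℕ) {m : ℕ}
    (h : ∀ i ∈ s, {l ∈ s | p l = p i}.encard ≤ m) :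
    ∃ σ : ι → ℕ, (∀ i ∈ s, σ i < m) ∧ ∀ i ∈ s, ∀ l ∈ s, σ i = σ l → p i = p l → i = l := by
  have hex (q : ℕ) : ∃ f : ι → ℕ, ∀ i ∈ s, p i = q →
      f i < m ∧ ∀ l ∈ s, p l = q → f i = f l → i = l := by
    by_cases hq : ∃ i ∈ s, p i = q
    · obtain ⟨i, hi, rfl⟩ := hq
      have hcard : {l ∈ s | p l = p i}.encard ≤ (Set.Iio m).encard := by
        refine (h i hi).trans_eq ?_
        rw [← Finset.coe_Iio, Set.encard_coe_eq_coe_finsetCard, Nat.card_Iio]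
      obtain ⟨f, hf, hinj⟩ := (Set.toFinite _).exists_injOn_of_encard_le hcard
      exact ⟨f, fun l hl hpl => ⟨hf ⟨hl, hpl⟩, fun l' hl' hpl' h => hinj ⟨hl, hpl⟩ ⟨hl', hpl'⟩ h⟩⟩
    · exact ⟨fun _ => 0, fun i hi hpi => absurd ⟨i, hi, hpi⟩ hq⟩
  choose f hf using hex
  refine ⟨fun i => f (p i) i, fun i hi => (hf _ i hi rfl).1, fun i hi l hl hil hpp => ?_⟩
  refine (hf _ i hi rfl).2 l hl hpp.symm ?_
  simpa only [hpp] using hil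

variable {ι : Type*} [Finite ι] {G : ι → Type*} [∀ i, Group (G i)] [∀ i, TopologicalSpace (G i)]
  [∀ i, IsTopologicalGroup (G i)] [∀ i, CompactSpace (G i)] [∀ i, T2Space (G i)]
  [∀ i, TotallyDisconnectedSpace (G i)]

theorem exists_le_topRank_le_of_factors (hG : ∀ i, IsHereditarilyJustInfinite (G i)) {m : ℕ}
    (hd : ∀ i, lowerRank (G i) ≤ m)
    (hr : ∀ p : ℕ, p.Prime → {i | IsVirtuallyZp p (G i)}.encard ≤ m)
    (U : OpenSubgroup (∀ i, G i)) : ∃ K ≤ U, topRank K.toSubgroup ≤ m := by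
  classical
  let W (i : ι) : OpenSubgroup (G i) := U.comap (MonoidHom.mulSingle G i) (continuous_mulSingle i)
  have hW : Subgroup.pi Set.univ (fun i => (W i).toSubgroup) ≤ U.toSubgroup := by
    rw [Subgroup.pi_le_iff]
    rintro i _ ⟨x, hx, rfl⟩
    exact hx
  have hp (i : ι) : ∃ p : ℕ, p.Prime ∧ (IsVirtuallyAbelian (G i) → IsVirtuallyZp p (G i)) := by
    by_cases h : IsVirtuallyAbelian (G i)
    · obtain ⟨p, hp, hpG⟩ := (hG i).exists_isVirtuallyZp h
      exact ⟨p, hp, fun _ => hpG⟩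
    -- An arbitrary prime: labels matter only for the virtually abelian factors.
    · exact ⟨2, Nat.prime_two, fun h' => absurd h' h⟩
  choose p hp hpG using hp
  obtain ⟨σ, hσm, hσ⟩ := exists_slots {i | IsVirtuallyAbelian (G i)} p (m := m) (by
    intro i hi
    refine (Set.encard_le_encard (t := {l | IsVirtuallyZp (p i) (G l)}) ?_).trans (hr _ (hp i))
    rintro l ⟨hl, hpl⟩
    exact hpl ▸ hpG l hl)
  choose! z A hAW hzA hzinf hzpow using
    fun i (hi : IsVirtuallyAbelian (G i)) => (hG i).exists_procyclic (hpG i hi) (W i)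
  let ν := {i // ¬ IsVirtuallyAbelian (G i)}
  obtain ⟨B, hBW, hBr, hB⟩ := exists_pairwise_nonisomorphic (G := fun i : ν => G i)
    (fun i => hG i) (fun i => (hd i).trans_lt (ENat.natCast_lt_top m)) (fun i => i.2) fun i => W i
  choose x hx using fun i : ν => exists_range_closure_eq (B i) ((hBr i).trans (hd i))
  obtain ⟨H, hHA, hHB⟩ : ∃ H : ∀ i, OpenSubgroup (G i),
      (∀ i, IsVirtuallyAbelian (G i) → H i = A i) ∧ ∀ i : ν, H i = B i :=
    ⟨fun i => if h : IsVirtuallyAbelian (G i) then A i else B ⟨i, h⟩,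
      fun i hi => dif_pos hi, fun i => dif_neg i.2⟩
  -- The `j`-th element carries the `j`-th generator in each factor that is not virtually abelian,
  -- and `z i` exactly in the virtually abelian factors assigned to slot `j`.
  obtain ⟨g, hgA, hgB⟩ : ∃ g : Fin m → ∀ i, G i,
      (∀ j i, IsVirtuallyAbelian (G i) → g j i = if σ i = j then z i else 1) ∧
      ∀ j, ∀ i : ν, g j i = x i j :=
    ⟨fun j i => if h : IsVirtuallyAbelian (G i) then if σ i = j then z i else 1 else x ⟨i, h⟩ j,
      fun j i hi => dif_pos hi, fun j i => dif_neg i.2⟩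
  set K := (Subgroup.closure (Set.range g)).topologicalClosure with hKdef
  have hKc : IsClosed (K : Set (∀ i, G i)) := Subgroup.isClosed_topologicalClosure _
  have hgK (j : Fin m) : g j ∈ K :=
    Subgroup.le_topologicalClosure _ (Subgroup.subset_closure ⟨j, rfl⟩)
  have hKH (i : ι) : K.map (Pi.evalMonoidHom G i) = (H i).toSubgroup := by
    rw [hKdef, map_topologicalClosure _ (continuous_apply i), MonoidHom.map_closure,
      ← Set.range_comp]
    by_cases hi : IsVirtuallyAbelian (G i)
    · rw [hHA i hi, ← hzA i hi, Subgroup.zpowers_eq_closure]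
      congr 1
      apply le_antisymm
      · rw [Subgroup.closure_le]
        rintro _ ⟨j, rfl⟩
        simp only [Function.comp_apply, Pi.evalMonoidHom_apply, hgA j i hi]
        split_ifs
        · exact Subgroup.subset_closure rfl
        · exact one_mem _
      · rw [Subgroup.closure_le, Set.singleton_subset_iff]
        exact Subgroup.subset_closure ⟨⟨σ i, hσm i hi⟩, by simp [hgA _ i hi]⟩
    · rw [hHB ⟨i, hi⟩, ← hx ⟨i, hi⟩]
      congr 3
      exact funext fun j => hgB j ⟨i, hi⟩
  have hKo : IsOpen (K : Set (∀ i, G i)) := by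
    refine isOpen_of_subdirect hG hKc hKH (fun i hi l hli => ?_) fun i hi => ?_
    · by_cases hl : IsVirtuallyAbelian (G l)
      -- `H l` is procyclic, hence abelian; an isomorphism would make the open subgroup `H i`
      -- abelian too.
      · refine ⟨fun e => hi ⟨H i, fun a ha b hb => ?_⟩⟩
        have hcomm (c d : (H l).toSubgroup) : c * d = d * c := by
          have hle : (H l).toSubgroup ≤ (Subgroup.zpowers (z l)).topologicalClosure := by
            rw [hHA l hl, hzA l hl]
          exact Subtype.ext (mul_comm_of_topologicalClosure_zpowers (hle c.2) (hle d.2))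
        have hab : (⟨a, ha⟩ * ⟨b, hb⟩ : (H i).toSubgroup) = ⟨b, hb⟩ * ⟨a, ha⟩ :=
          e.injective (by rw [map_mul, map_mul, hcomm])
        exact congrArg Subtype.val hab
      · rw [hHB ⟨i, hi⟩, hHB ⟨l, hl⟩]
        exact hB ⟨i, hi⟩ ⟨l, hl⟩ fun h => hli (congrArg Subtype.val h).symm
    · let α := {i // IsVirtuallyAbelian (G i)}
      let π : (∀ i, G i) →* ∀ a : α, G a := MonoidHom.pi fun a : α => Pi.evalMonoidHom G a
      have hπ : Continuous π := continuous_pi fun a => continuous_apply (a : ι)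
      -- After projection to the virtually abelian coordinates, the nontrivial components of the
      -- generator in slot `σ i` belong to distinct primes, so the component at `i` can be isolated;
      -- lifting it back to `K` gives the required `k`.
      have hmem := mulSingle_mem_of_coprime (isClosed_map_of_isClosed π hπ hKc)
        (w := π (g ⟨σ i, hσm i hi⟩)) ⟨_, hgK _, rfl⟩ (fun a => p a) (fun a => hp a) ⟨i, hi⟩
        (fun a V => by
          change ∃ k, g _ a ^ p a ^ k ∈ V
          rw [hgA _ a a.2]
          split_ifs
          · exact hzpow a a.2 V
          · exact ⟨0, by simp⟩)
        (fun a ha hw hpa => by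
          change g _ a ≠ 1 at hw
          rw [hgA _ a a.2] at hw
          refine ha (Subtype.ext (hσ a a.2 i hi ?_ hpa))
          by_contra hne
          exact hw (if_neg hne))
      obtain ⟨k, hk, hkπ⟩ := hmem
      have hki : k i = z i := by
        have := congrFun hkπ ⟨i, hi⟩
        rw [Pi.mulSingle_eq_same] at this
        refine this.trans ((hgA _ i hi).trans (if_pos rfl))
      refine ⟨k, hk, fun s hs => hki ▸ hzinf i hi s hs, fun l hl hli => ?_⟩
      have := congrFun hkπ ⟨l, hl⟩
      rwa [Pi.mulSingle_eq_of_ne (fun h => hli (congrArg Subtype.val h))] at this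
  refine ⟨⟨K, hKo⟩, fun k hk => hW fun i _ => ?_, topRank_topologicalClosure_le g⟩
  have hkH : k i ∈ (H i).toSubgroup := hKH i ▸ Subgroup.mem_map_of_mem _ hk
  by_cases hi : IsVirtuallyAbelian (G i)
  · exact hAW i hi (hHA i hi ▸ hkH)
  · exact hBW ⟨i, hi⟩ (hHB ⟨i, hi⟩ ▸ hkH)

end UpperBound

theorem theoremA (n : ℕ) (G : Fin n → Type*)
    [∀ i, Group (G i)] [∀ i, TopologicalSpace (G i)] [∀ i, IsTopologicalGroup (G i)]
    [∀ i, CompactSpace (G i)] [∀ i, T2Space (G i)] [∀ i, TotallyDisconnectedSpace (G i)]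
    (hG : Nontrivial (∀ i, G i))
    (hji : ∀ i, IsHereditarilyJustInfinite (G i))
    (hfin : ∀ i, lowerRank (G i) < ⊤) :
    lowerRank (∀ i, G i) =
      max (⨆ i, lowerRank (G i))
        (⨆ p : Nat.Primes, {i : Fin n | IsVirtuallyZp (p : ℕ) (G i)}.encard) := by
  apply le_antisymm
  · set M := max (⨆ i, lowerRank (G i))
      (⨆ p : Nat.Primes, {i : Fin n | IsVirtuallyZp (p : ℕ) (G i)}.encard) with hM
    rcases eq_or_ne M ⊤ with htop | htop
    · rw [htop]
      exact le_top
    · lift M to ℕ using htop with m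
      refine lowerRank_le fun U => exists_le_topRank_le_of_factors hji (fun i => ?_)
        (fun p hp => ?_) U
      · exact hM ▸ (le_iSup (fun i => lowerRank (G i)) i).trans (le_max_left _ _)
      · exact hM ▸ (le_iSup (fun p : Nat.Primes =>
          {i : Fin n | IsVirtuallyZp (p : ℕ) (G i)}.encard) ⟨p, hp⟩).trans (le_max_right _ _)
  · exact max_le (iSup_le fun i => lowerRank_le_lowerRank_pi i)
      (iSup_le fun p => encard_isVirtuallyZp_le_lowerRank hji p.2)
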